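/- **Setting.** Fix a signature $\Sigma$ of predicate symbols whose only function symbols are the constants of a non-empty domain $\mathcal D$, and an infinite set of variables. A literal is a possibly negated atom, a clause is a finite multiset of literals ($\bot$ is the empty clause), and $\neg L$ denotes the complement of $L$. An interpretation is a set $I$ of ground atoms; $I\models C$ if every ground instance of $C$ over $\mathcal D$ has a true literal, and $\models$ between clause sets and clauses is the corresponding consequence relation. Independent expressions are renamed to be variable disjoint where necessary. A *dismatching constraint* is a finite conjunction $\pi=\bigwedge_i \vec s_i\neq\vec t_i$, where the variables of each $\vec t_i$ occur nowhere else; $\top$ and $\bot$ are the trivial and the unsatisfiable constraint. A grounding substitution $\delta$ *solves* $\pi$ if no $\vec s_i\delta$ is an instance of $\vec t_i$. Put $\mathrm{gnd}(E;\pi)=\{E\delta : \delta \text{ solves } \pi\}$ for a literal or clause $E$ (variables of $\pi$ not in $E$ are existential), and call $(E;\pi)$ *empty* if this set is empty. Constraints are taken up to having the same solutions; $\pi,\pi'$ denotes conjunction. A *trail* $\Gamma$ is a finite sequence of decisions $(L;\pi)^i$ ($i\in\mathbb N$) and deduced literals $(L\cdot\sigma;\pi)^{C\vee L}$; such an element covers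 the ground literals in $\mathrm{gnd}(L;\pi)$, respectively $\mathrm{gnd}(L\sigma;\pi)$. A ground literal is *true* (*false*) under $\Gamma$ if it (its complement) is covered by an element of $\Gamma$, and *defined* if it is true or false. A ground clause is false if all its literals are false; $(C;\pi)$ is false if every clause in $\mathrm{gnd}(C;\pi)$ is false; $(L;\pi)$ is *undefined* if no literal in $\mathrm{gnd}(L;\pi)$ is defined. The level $\mathrm{lvl}(\Gamma)$ is the annotation of the last decision in $\Gamma$ ($0$ if there is none); the level of a defined ground literal is the level of the part of $\Gamma$ up to and including the element defining it; it is *top-level* if its level is $\mathrm{lvl}(\Gamma)$. A ground clause is *assertive* if it is false and contains exactly one occurrence of a top-level literal; $(C;\pi)$ is assertive if some clause in $\mathrm{gnd}(C;\pi)$ is. $I_\Gamma$ is the set of true ground atoms. A decision $(L;\pi)$ is *blocked* in $\Gamma$ by $C$ if $(L;\pi)$ is undefined in $\Gamma$ and some ground instance of $C$ is false under $\Gamma,(L;\pi)$ and contains literals $L_1\neq L_2$ with $\neg L_1,\neg L_2\in\mathrm{gnd}(L;\pi)$. **The calculus NRCL.** *States* are tuples $(\Gamma;N;U;k;s)$ with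 clause sets $N,U$, an integer $k\ge -1$, and $s\in\{\top,\bot\}$ or $s=(C;\sigma;\pi)$. Rules for conflict search: * *Propagate*: $(\Gamma;N;U;k;\top)\Rightarrow(\Gamma,(L\cdot\sigma;\pi)^{C\vee L};N;U;k;\top)$ if $k\ge0$, $C\vee L\in N\cup U$, $(C\sigma;\pi)$ is false under $\Gamma$, and $(L\sigma;\pi)$ is undefined in $\Gamma$ and not empty. * *Decide*: $(\Gamma;N;U;k;\top)\Rightarrow(\Gamma,(L;\pi)^{k+1};N;U;k+1;\top)$ if $k\ge0$, $(L;\pi)$ is undefined in $\Gamma$, not blocked in $\Gamma$ by any clause of $N\cup U$, and not empty, and $L$ or $\neg L$ is an instance of a literal of a clause in $N$. * *Conflict*: $(\Gamma;N;U;k;\top)\Rightarrow(\Gamma;N;U;k;(C;\sigma;\pi))$ if $k\ge0$, $\bot\neq C\in N\cup U$, and $(C\sigma;\pi)$ is false under $\Gamma$ and not empty. * *Success*: $(\Gamma;N;U;k;\top)\Rightarrow(\Gamma;N;U;-1;\top)$ if $k\ge0$ and $I_\Gamma\models N$. * *Failure*: $(\Gamma;N;U;k;\top)\Rightarrow(\Gamma;N;U;0;\bot)$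 if $\bot\in N\cup U$. Rules for conflict resolution, where $\ell$ is the last element of the trail, with closure $L'\cdot\sigma'$ ($\sigma'$ the identity for a decision) and constraint $\pi'$: * *Skip*: $(\Gamma,\ell;N;U;k;(C;\sigma;\pi))\Rightarrow(\Gamma;N;U;k;(C;\sigma;\pi))$ if $\ell$ is deduced and there is no $L\in C$ such that $\eta=\mathrm{mgu}(L'\sigma',\neg L\sigma)$ exists and $(C\sigma\eta;\pi\eta,\pi'\eta)$ is not empty. * *Resolve*: $(\Gamma,\ell;N;U;k;(C\vee L;\sigma;\pi))\Rightarrow(\Gamma,\ell;N;U;k;((C\vee C')\eta_0;\sigma^*;\pi\eta,\pi'\eta))$ if $\ell=(L'\cdot\sigma';\pi')^{C'\vee L'}$ is deduced, $((C\vee L)\sigma;\pi)$ is not assertive or $k=0$, $\eta=\mathrm{mgu}(L'\sigma',\neg L\sigma)$ and $\eta_0=\mathrm{mgu}(L',\neg L)$ exist, $\eta_0\sigma^*=\sigma\sigma'\eta$, and $((C\vee L)\sigma\eta;\pi\eta,\pi'\eta)$ is not empty. * *Factorize*: $(\Gamma,\ell;N;U;k;(C\vee L_1\vee L_2;\sigma;\pi))\Rightarrow(\Gamma,\ell;N;U;k;((C\vee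 L_1)\eta_0;\sigma^*;\pi\eta))$ if $\eta=\mathrm{mgu}\{L_1\sigma,L_2\sigma,\neg L'\sigma'\}$ and $\eta_0=\mathrm{mgu}(L_1,L_2)$ exist, $\eta_0\sigma^*=\sigma\eta$, and $((C\vee L_1)\sigma\eta;\pi\eta,\pi'\eta)$ is not empty. * *Backjump*: $(\Gamma_1,\Gamma_2;N;U;k;(C;\sigma;\pi))\Rightarrow(\Gamma_1;N;U\cup\{C\};k';\top)$ if $0\le k'=\mathrm{lvl}(\Gamma_1)\le k$ and one of the following holds: (1) $k=0$ and $C=\bot$; (2) $k>0$, $(C\sigma;\pi)$ is assertive, and no ground instance of $C$ is false under $\Gamma_1$; (3) $k>0$, the last element of $\Gamma_2$ is the top-level decision, $(C\sigma;\pi)$ is not assertive, *Factorize* is not applicable, and no ground instance of $C$ is false under $\Gamma_1$. **Regular runs.** A state $(\Gamma;N;U;k;s)$ is *sound* if: no ground literal is both true and false under $\Gamma$; if $k\ge0$ then $\Gamma$ has exactly $k$ decisions; each $i\in\{1,\dots,k\}$ annotates exactly one decision and the decisions occur in the order of their annotations; every element of $\Gamma$ satisfies the conditions of *Decide*, respectively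 *Propagate*, with respect to $N$, $U$ and the part of $\Gamma$ before it; $N\models U$; $s=\bot$ implies $\bot\in N\cup U$; $k=-1$ implies $I_\Gamma\models N$; and if $s=(C;\sigma;\pi)$ then $(C\sigma;\pi)$ is false under $\Gamma$ and not empty, and $N\models C$. A sound state is *regular* if no clause of $N\cup U$ has a ground instance that is false under $\Gamma$ without its last element, and *Propagate* is not applicable, with respect to $N\cup U$, to the part of $\Gamma$ before any decision. A *run* from $N$ is a finite or infinite sequence of states, starting in a sound state with clause set $N$, in which each further state results from its predecessor by a rule. It is *regular* if the starting state is regular; if conflict search always gives priority to the rules in the order: terminal rules (*Success*, *Failure*), *Conflict*, *Propagate*, *Decide* (or, alternatively, throughout the run in the order *Failure*, *Conflict*, *Propagate*, *Decide*, *Success*); and if in conflict resolution *Backjump* is applied whenever it is applicable, and always leads to a regular state. **Theorem (Termination).** If $N$, $\Sigma$ and $\mathcal D$ are finite, then every regular run from $N$ terminates, i.e. is finite. -/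

import Mathlib

universe u v w

namespace NRCL

/-! ### Syntax: function-free clauses -/

/-- A signature of the effectively propositional fragment: predicate symbols with arities and
constants. The set of constants is the domain `𝒟`. -/
structure Signature where
  Pred : Type u
  arity : Pred → ℕ
  Const : Type v

/-- Terms: variables and constants. -/
inductive Tm (D : Type v) (V : Type w) where
  | var : V → Tm D V
  | const : D → Tm D V

/-- Application of a substitution to a term. -/
def Tm.subst {D : Type v} {V : Type w} (σ : V → Tm D V) : Tm D V → Tm D V
  | .var x => σ x
  | .const c => .const c

/-- Application of a grounding substitution `δ : V → 𝒟` to a term. -/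
def Tm.ground {D : Type v} {V : Type w} (δ : V → D) : Tm D V → D
  | .var x => δ x
  | .const c => c

/-- The variables of a term. -/
def Tm.vars {D : Type v} {V : Type w} : Tm D V → Set V
  | .var x => {x}
  | .const _ => ∅

/-- Atoms with arguments in `T`. Ground atoms have `T = S.Const`; first-order atoms have
`T = Tm S.Const V`. -/
structure Atom (S : Signature.{u, v}) (T : Type*) where
  pred : S.Pred
  args : Fin (S.arity pred) → T

/-- Literals; `pos = true` for a positive literal. -/
structure Lit (S : Signature.{u, v}) (T : Type*) where
  pos : Bool
  atom : Atom S T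

/-- The complementary literal. -/
def Lit.neg {S : Signature.{u, v}} {T : Type*} (L : Lit S T) : Lit S T := ⟨!L.pos, L.atom⟩

/-- Apply a function to all arguments of a literal. -/
def Lit.map {S : Signature.{u, v}} {T T' : Type*} (f : T → T') (L : Lit S T) : Lit S T' :=
  ⟨L.pos, ⟨L.atom.pred, fun i => f (L.atom.args i)⟩⟩

/-- Clauses are finite multisets of literals; `0` is the empty clause `⊥`, and `L ::ₘ C` is
`C ∨ L`. -/
abbrev Clause (S : Signature.{u, v}) (T : Type*) := Multiset (Lit S T)

/-- First-order literals. -/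
abbrev FLit (S : Signature.{u, v}) (V : Type w) := Lit S (Tm S.Const V)
/-- First-order clauses. -/
abbrev FClause (S : Signature.{u, v}) (V : Type w) := Clause S (Tm S.Const V)
/-- Ground literals. -/
abbrev GLit (S : Signature.{u, v}) := Lit S S.Const
/-- Ground clauses. -/
abbrev GClause (S : Signature.{u, v}) := Clause S S.Const
/-- Substitutions. -/
abbrev Subst (S : Signature.{u, v}) (V : Type w) := V → Tm S.Const V

section

variable {S : Signature.{u, v}} {V : Type w}

def Lit.subst (σ : Subst S V) (L : FLit S V) : FLit S V := L.map (Tm.subst σ)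

def Lit.ground (δ : V → S.Const) (L : FLit S V) : GLit S := L.map (Tm.ground δ)

def Lit.vars (L : FLit S V) : Set V := {x | ∃ i, x ∈ (L.atom.args i).vars}

def Clause.subst (σ : Subst S V) (C : FClause S V) : FClause S V := Multiset.map (Lit.subst σ) C

def Clause.ground (δ : V → S.Const) (C : FClause S V) : GClause S := Multiset.map (Lit.ground δ) C

def Clause.vars (C : FClause S V) : Set V := {x | ∃ L ∈ C, x ∈ Lit.vars L}

/-- The substitution that performs the variable renaming `ρ`. -/
def renameSubst (ρ : V → V) : Subst S V := fun x => .var (ρ x)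

/-- The composition `σ τ`: first `σ`, then `τ`. -/
def comp (σ τ : Subst S V) : Subst S V := fun x => (σ x).subst τ

/-- `η` is a most general unifier of the literals in `A`. -/
def IsMGU (η : Subst S V) (A : Set (FLit S V)) : Prop :=
  (∀ L ∈ A, ∀ M ∈ A, L.subst η = M.subst η) ∧
    ∀ θ : Subst S V, (∀ L ∈ A, ∀ M ∈ A, L.subst θ = M.subst θ) →
      ∃ τ : Subst S V, θ = comp η τ

end

/-! ### Dismatching constraints and constrained expressions -/

/-- An atomic dismatching constraint `s⃗ ≠ t⃗`. The variables of the right-hand side `t⃗` are local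
to the atomic constraint, which builds in that right-hand side variables differ from all other
variables: a substitution acts on the left-hand side only. -/
structure Diseq (S : Signature.{u, v}) (V : Type w) where
  dim : ℕ
  lhs : Fin dim → Tm S.Const V
  rhs : Fin dim → Tm S.Const V

/-- A dismatching constraint: a finite conjunction of atomic ones. The constant `⊤` is the empty
conjunction, and the constant `⊥` is `() ≠ ()`. -/
abbrev Constraint (S : Signature.{u, v}) (V : Type w) := List (Diseq S V)

section

variable {S : Signature.{u, v}} {V : Type w}

def Diseq.subst (σ : Subst S V) (d : Diseq S V) : Diseq S V :=
  ⟨d.dim, fun i => (d.lhs i).subst σ, d.rhs⟩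

def Constraint.subst (σ : Subst S V) (π : Constraint S V) : Constraint S V :=
  List.map (Diseq.subst σ) π

/-- The left-hand side variables of a constraint. -/
def Constraint.lvars (π : Constraint S V) : Set V := {x | ∃ d ∈ π, ∃ i, x ∈ (d.lhs i).vars}

/-- Conjunction of constraints. -/
def Constraint.and (π π' : Constraint S V) : Constraint S V := List.append π π'

/-- `δ` is a solution of `π`: for no atomic constraint `s⃗ ≠ t⃗` of `π`, `s⃗δ` is an instance of
`t⃗`. -/
def Constraint.Solution (π : Constraint S V) (δ : V → S.Const) : Prop :=
  ∀ d ∈ π, ¬ ∃ ε : V → S.Const, ∀ i, (d.lhs i).ground δ = (d.rhs i).ground ε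

/-- Constraints are equivalent if they have the same solutions. -/
def Constraint.Equivalent (π π' : Constraint S V) : Prop :=
  ∀ δ : V → S.Const, π.Solution δ ↔ π'.Solution δ

/-- The ground literals covered by the constrained literal `(L; π)`. Variables of `π` that do not
occur in `L` are existential. -/
def gndLit (L : FLit S V) (π : Constraint S V) : Set (GLit S) :=
  {l | ∃ δ : V → S.Const, π.Solution δ ∧ L.ground δ = l}

/-- The ground clauses covered by the constrained clause `(C; π)`. -/
def gndClause (C : FClause S V) (π : Constraint S V) : Set (GClause S) :=
  {G | ∃ δ : V → S.Const, π.Solution δ ∧ Clause.ground δ C = G}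

/-- The ground instances of a clause. -/
def gnd (C : FClause S V) : Set (GClause S) := {G | ∃ δ : V → S.Const, Clause.ground δ C = G}

/-! ### Semantics -/

/-- Truth of a ground literal in an interpretation, given as its set of true ground atoms. -/
def SatLit (I : Set (Atom S S.Const)) (l : GLit S) : Prop :=
  (l.pos = true ∧ l.atom ∈ I) ∨ (l.pos = false ∧ l.atom ∉ I)

/-- `I ⊨ C`: every ground instance of `C` contains a true literal. -/
def Models (I : Set (Atom S S.Const)) (C : FClause S V) : Prop :=
  ∀ G ∈ gnd C, ∃ l ∈ G, SatLit I l

/-- `N ⊨ C`. -/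
def Entails (N : Set (FClause S V)) (C : FClause S V) : Prop :=
  ∀ I : Set (Atom S S.Const), (∀ D ∈ N, Models I D) → Models I C

end

/-! ### Trails -/

/-- Elements of the trail: a decision `(L; π)^i`, or a deduced literal `(L·σ; π)^{C ∨ L}` with its
reason clause `C ∨ L`, given by `L` and the remaining clause `C`. -/
inductive Assignment (S : Signature.{u, v}) (V : Type w) where
  | decision (L : FLit S V) (π : Constraint S V) (i : ℕ)
  | deduced (L : FLit S V) (σ : Subst S V) (π : Constraint S V) (C : FClause S V)

/-- A trail, most recent assignment first: `a :: Γ` stands for the trail `Γ, a`, and `Γ₂ ++ Γ₁` for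
`Γ₁, Γ₂`. -/
abbrev Trail (S : Signature.{u, v}) (V : Type w) := List (Assignment S V)

section

variable {S : Signature.{u, v}} {V : Type w}

/-- The literal `Lσ` of an assignment (decisions have the empty closure). -/
def Assignment.lit : Assignment S V → FLit S V
  | .decision L _ _ => L
  | .deduced L σ _ _ => L.subst σ

def Assignment.constr : Assignment S V → Constraint S V
  | .decision _ π _ => π
  | .deduced _ _ π _ => π

/-- The variables occurring in an assignment: those of `Lσ`, of the left-hand sides of `π`, and of
`Cσ` if `C ∨ L` is the reason. -/
def Assignment.vars : Assignment S V → Set V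
  | .decision L π _ => L.vars ∪ π.lvars
  | .deduced L σ π C => Clause.vars (Clause.subst σ (L ::ₘ C)) ∪ π.lvars

/-- The ground literals covered by an assignment. -/
def Assignment.covers (a : Assignment S V) : Set (GLit S) := gndLit a.lit a.constr

/-- The assignment `a` defines the ground literal `l`: it covers `l` or its complement. -/
def Assignment.Defines (a : Assignment S V) (l : GLit S) : Prop :=
  l ∈ a.covers ∨ l.neg ∈ a.covers

/-- The level of the trail: the annotation of its last decision, `0` if there is none. -/
def level : Trail S V → ℕ
  | [] => 0
  | .decision _ _ i :: _ => i
  | .deduced _ _ _ _ :: Γ => level Γ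

/-- The annotations of the decisions of a trail, most recent first. -/
def decisionLabels : Trail S V → List ℕ
  | [] => []
  | .decision _ _ i :: Γ => i :: decisionLabels Γ
  | .deduced _ _ _ _ :: Γ => decisionLabels Γ

def DefinedLit (Γ : Trail S V) (l : GLit S) : Prop := ∃ a ∈ Γ, a.Defines l

def TrueLit (Γ : Trail S V) (l : GLit S) : Prop := ∃ a ∈ Γ, l ∈ a.covers

def FalseLit (Γ : Trail S V) (l : GLit S) : Prop := ∃ a ∈ Γ, l.neg ∈ a.covers

/-- A ground clause is false under `Γ` if all its literals are. -/
def FalseG (Γ : Trail S V) (G : GClause S) : Prop := ∀ l ∈ G, FalseLit Γ l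

/-- `(C; π)` is false under `Γ`: all covered ground clauses are false. -/
def FalseC (Γ : Trail S V) (C : FClause S V) (π : Constraint S V) : Prop :=
  ∀ G ∈ gndClause C π, FalseG Γ G

/-- `(L; π)` is undefined in `Γ`: no covered ground literal is defined. -/
def UndefinedL (Γ : Trail S V) (L : FLit S V) (π : Constraint S V) : Prop :=
  ∀ l ∈ gndLit L π, ¬ DefinedLit Γ l

/-- The clause `C` has a ground instance that is false under `Γ`. -/
def HasFalseInstance (Γ : Trail S V) (C : FClause S V) : Prop := ∃ G ∈ gnd C, FalseG Γ G

/-- The ground literal `l` is defined in `Γ` and its level is `n`: the level of the last decision up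
to the assignment that defines `l`. -/
def HasLevel (Γ : Trail S V) (l : GLit S) (n : ℕ) : Prop :=
  ∃ Γ₂ a Γ₁, Γ = Γ₂ ++ a :: Γ₁ ∧ a.Defines l ∧ level (a :: Γ₁) = n

/-- A ground clause is assertive: it is false and contains exactly one (occurrence of a) literal of
top level. -/
def AssertiveG (Γ : Trail S V) (G : GClause S) : Prop :=
  FalseG Γ G ∧ ∃ l G', G = l ::ₘ G' ∧ HasLevel Γ l (level Γ) ∧
    ∀ l' ∈ G', ¬ HasLevel Γ l' (level Γ)

/-- `(C; π)` is assertive: it covers an assertive ground clause. -/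
def AssertiveC (Γ : Trail S V) (C : FClause S V) (π : Constraint S V) : Prop :=
  ∃ G ∈ gndClause C π, AssertiveG Γ G

/-- The interpretation `I_Γ` induced by `Γ`. -/
def inducedInterp (Γ : Trail S V) : Set (Atom S S.Const) :=
  {A | TrueLit Γ ⟨true, A⟩}

/-- The decision `(L; π)` is blocked in `Γ` by the clause `C`. -/
def Blocked (Γ : Trail S V) (L : FLit S V) (π : Constraint S V) (C : FClause S V) : Prop :=
  ∃ G ∈ gnd C, ∃ l₁ ∈ G, ∃ l₂ ∈ G,
    FalseG (.decision L π (level Γ + 1) :: Γ) G ∧ UndefinedL Γ L π ∧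
      l₁.neg ∈ gndLit L π ∧ l₂.neg ∈ gndLit L π ∧ l₁ ≠ l₂

/-- The conditions of *Propagate* for deducing `(L·σ; π)^{C ∨ L}` from the clause set `M` and the
trail `Γ`. -/
def PropagateCond (M : Set (FClause S V)) (Γ : Trail S V) (L : FLit S V) (σ : Subst S V)
    (π : Constraint S V) (C : FClause S V) : Prop :=
  (L ::ₘ C) ∈ M ∧ FalseC Γ (Clause.subst σ C) π ∧ UndefinedL Γ (L.subst σ) π ∧
    (gndLit (L.subst σ) π).Nonempty

/-- The conditions of *Decide* for the decision `(L; π)`. -/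
def DecideCond (N U : Set (FClause S V)) (Γ : Trail S V) (L : FLit S V)
    (π : Constraint S V) : Prop :=
  UndefinedL Γ L π ∧ (∀ C ∈ N ∪ U, ¬ Blocked Γ L π C) ∧ (gndLit L π).Nonempty ∧
    ∃ C ∈ N, ∃ L' ∈ C, ∃ δ : Subst S V, L = L'.subst δ ∨ L = (L'.subst δ).neg

end

/-! ### States -/

/-- State indicators: `⊤`, `⊥`, or a conflict `(C; σ; π)`. -/
inductive Indicator (S : Signature.{u, v}) (V : Type w) where
  | top
  | bot
  | conflict (C : FClause S V) (σ : Subst S V) (π : Constraint S V)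

/-- States `(Γ; N; U; k; s)`. -/
structure State (S : Signature.{u, v}) (V : Type w) where
  trail : Trail S V
  clauses : Set (FClause S V)
  learned : Set (FClause S V)
  k : ℤ
  ind : Indicator S V

section

variable {S : Signature.{u, v}} {V : Type w}

/-- Sound states. -/
structure State.Sound (s : State S V) : Prop where
  /-- `k` is a non-negative integer, or `-1` after *Success*. -/
  k_ge : -1 ≤ s.k
  consistent : ∀ l, ¬ (TrueLit s.trail l ∧ FalseLit s.trail l)
  decision_count : 0 ≤ s.k → ((decisionLabels s.trail).length : ℤ) = s.k
  decision_unique : ∀ i : ℕ, 1 ≤ i → (i : ℤ) ≤ s.k → (decisionLabels s.trail).count i = 1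
  decision_order : (decisionLabels s.trail).Pairwise (· > ·)
  decision_cond : ∀ Γ₂ L π i Γ₁, s.trail = Γ₂ ++ Assignment.decision L π i :: Γ₁ →
    DecideCond s.clauses s.learned Γ₁ L π
  deduced_cond : ∀ Γ₂ L σ π C Γ₁, s.trail = Γ₂ ++ Assignment.deduced L σ π C :: Γ₁ →
    PropagateCond (s.clauses ∪ s.learned) Γ₁ L σ π C
  entails : ∀ C ∈ s.learned, Entails s.clauses C
  bot : s.ind = .bot → (0 : FClause S V) ∈ s.clauses ∪ s.learned
  success : s.k = -1 → ∀ C ∈ s.clauses, Models (inducedInterp s.trail) C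
  conflict : ∀ C σ π, s.ind = .conflict C σ π →
    FalseC s.trail (Clause.subst σ C) π ∧ Entails s.clauses C ∧
      (gndClause (Clause.subst σ C) π).Nonempty

/-- Regular states. -/
structure State.Regular (s : State S V) : Prop where
  sound : s.Sound
  no_false : ∀ a Γ', s.trail = a :: Γ' →
    ∀ C ∈ s.clauses ∪ s.learned, ¬ HasFalseInstance Γ' C
  propagate_exhausted : ∀ Γ₂ L π i Γ₁, s.trail = Γ₂ ++ Assignment.decision L π i :: Γ₁ →
    ¬ ∃ L' σ' π' C', PropagateCond (s.clauses ∪ s.learned) Γ₁ L' σ' π' C'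

/-! ### Rules for conflict search -/

inductive Propagate : State S V → State S V → Prop
  | mk (Γ : Trail S V) (N U : Set (FClause S V)) (k : ℕ) (L : FLit S V) (σ : Subst S V)
      (π : Constraint S V) (C : FClause S V) (h : PropagateCond (N ∪ U) Γ L σ π C) :
      Propagate ⟨Γ, N, U, k, .top⟩ ⟨.deduced L σ π C :: Γ, N, U, k, .top⟩

inductive Decide : State S V → State S V → Prop
  | mk (Γ : Trail S V) (N U : Set (FClause S V)) (k : ℕ) (L : FLit S V) (π : Constraint S V)
      (h : DecideCond N U Γ L π) :
      Decide ⟨Γ, N, U, k, .top⟩ ⟨.decision L π (k + 1) :: Γ, N, U, k + 1, .top⟩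

inductive Conflict : State S V → State S V → Prop
  | mk (Γ : Trail S V) (N U : Set (FClause S V)) (k : ℕ) (C : FClause S V) (σ : Subst S V)
      (π : Constraint S V) (hC : C ∈ N ∪ U) (hbot : C ≠ 0)
      (hfalse : FalseC Γ (Clause.subst σ C) π)
      (hne : (gndClause (Clause.subst σ C) π).Nonempty) :
      Conflict ⟨Γ, N, U, k, .top⟩ ⟨Γ, N, U, k, .conflict C σ π⟩

inductive Success : State S V → State S V → Prop
  | mk (Γ : Trail S V) (N U : Set (FClause S V)) (k : ℕ)
      (h : ∀ C ∈ N, Models (inducedInterp Γ) C) :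
      Success ⟨Γ, N, U, k, .top⟩ ⟨Γ, N, U, -1, .top⟩

inductive Failure : State S V → State S V → Prop
  | mk (Γ : Trail S V) (N U : Set (FClause S V)) (k : ℤ) (h : (0 : FClause S V) ∈ N ∪ U) :
      Failure ⟨Γ, N, U, k, .top⟩ ⟨Γ, N, U, 0, .bot⟩

/-! ### Rules for conflict resolution

Independent expressions are variable disjoint by convention. The renamings `ρ`, `ρ₀` below make this
explicit. Results of operations on constraints are taken up to equivalence of constraints, which
leaves room for normalization. -/

/-- The renaming `ρ` makes the assignment `a` variable disjoint from `(C; σ; π)`. -/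
def Apart (ρ : V → V) (a : Assignment S V) (C : FClause S V) (σ : Subst S V)
    (π : Constraint S V) : Prop :=
  Function.Injective ρ ∧ Disjoint (ρ '' a.vars) (Clause.vars (Clause.subst σ C) ∪ π.lvars)

/-- `πη, π'η` where `π'` is the constraint of the (renamed) assignment `a`. -/
def jointConstraint (ρ : V → V) (a : Assignment S V) (π : Constraint S V) (η : Subst S V) :
    Constraint S V :=
  (π.subst η).and ((a.constr.subst (renameSubst ρ)).subst η)

inductive Skip : State S V → State S V → Prop
  | mk (Γ : Trail S V) (N U : Set (FClause S V)) (k : ℤ) (C : FClause S V) (σ : Subst S V)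
      (π : Constraint S V) (a : Assignment S V)
      (ha : ∃ L' σ' π' C', a = .deduced L' σ' π' C')
      (h : ¬ ∃ L ∈ C, ∃ ρ η, Apart ρ a C σ π ∧
        IsMGU η {a.lit.subst (renameSubst ρ), (L.subst σ).neg} ∧
        (gndClause (Clause.subst η (Clause.subst σ C)) (jointConstraint ρ a π η)).Nonempty) :
      Skip ⟨a :: Γ, N, U, k, .conflict C σ π⟩ ⟨Γ, N, U, k, .conflict C σ π⟩

inductive Resolve : State S V → State S V → Prop
  | mk (Γ : Trail S V) (N U : Set (FClause S V)) (k : ℤ)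
      (C : FClause S V) (L : FLit S V) (σ : Subst S V) (π : Constraint S V)
      (a : Assignment S V) (L' : FLit S V) (σ' : Subst S V) (π' : Constraint S V)
      (C' : FClause S V) (ha : a = .deduced L' σ' π' C')
      (ρ ρ₀ : V → V) (η η₀ σs : Subst S V) (πs : Constraint S V)
      (hassert : ¬ AssertiveC (a :: Γ) (Clause.subst σ (L ::ₘ C)) π ∨ k = 0)
      (hρ : Apart ρ a (L ::ₘ C) σ π)
      (hη : IsMGU η {a.lit.subst (renameSubst ρ), (L.subst σ).neg})
      (hρ₀ : Function.Injective ρ₀ ∧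
        Disjoint (ρ₀ '' Clause.vars (L' ::ₘ C')) (Clause.vars (L ::ₘ C)))
      (hη₀ : IsMGU η₀ {L'.subst (renameSubst ρ₀), L.neg})
      (hσ : ∀ x ∈ Clause.vars (L ::ₘ C), (η₀ x).subst σs = (σ x).subst η)
      (hσ' : ∀ x ∈ Clause.vars (L' ::ₘ C'),
        (η₀ (ρ₀ x)).subst σs = ((σ' x).subst (renameSubst ρ)).subst η)
      (hne : (gndClause (Clause.subst η (Clause.subst σ (L ::ₘ C)))
        (jointConstraint ρ a π η)).Nonempty)
      (hπ : Constraint.Equivalent πs (jointConstraint ρ a π η)) :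
      Resolve ⟨a :: Γ, N, U, k, .conflict (L ::ₘ C) σ π⟩
        ⟨a :: Γ, N, U, k,
          .conflict (Clause.subst η₀ (C + Clause.subst (renameSubst ρ₀) C')) σs πs⟩

inductive Factorize : State S V → State S V → Prop
  | mk (Γ : Trail S V) (N U : Set (FClause S V)) (k : ℤ)
      (C : FClause S V) (L₁ L₂ : FLit S V) (σ : Subst S V) (π : Constraint S V)
      (a : Assignment S V) (ρ : V → V) (η η₀ σs : Subst S V) (πs : Constraint S V)
      (hρ : Apart ρ a (L₁ ::ₘ L₂ ::ₘ C) σ π)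
      (hη : IsMGU η {L₁.subst σ, L₂.subst σ, (a.lit.subst (renameSubst ρ)).neg})
      (hη₀ : IsMGU η₀ {L₁, L₂})
      (hσ : ∀ x ∈ Clause.vars (L₁ ::ₘ L₂ ::ₘ C), (η₀ x).subst σs = (σ x).subst η)
      (hne : (gndClause (Clause.subst η (Clause.subst σ (L₁ ::ₘ C)))
        (jointConstraint ρ a π η)).Nonempty)
      (hπ : Constraint.Equivalent πs (π.subst η)) :
      Factorize ⟨a :: Γ, N, U, k, .conflict (L₁ ::ₘ L₂ ::ₘ C) σ π⟩
        ⟨a :: Γ, N, U, k, .conflict (Clause.subst η₀ (L₁ ::ₘ C)) σs πs⟩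

/-- A rule is applicable to a state. -/
def Applicable (R : State S V → State S V → Prop) (s : State S V) : Prop := ∃ s', R s s'

inductive Backjump : State S V → State S V → Prop
  | mk (Γ₁ Γ₂ : Trail S V) (N U : Set (FClause S V)) (k : ℤ) (C : FClause S V)
      (σ : Subst S V) (π : Constraint S V)
      (hk : (level Γ₁ : ℤ) ≤ k)
      (h : (k = 0 ∧ C = 0) ∨
        (0 < k ∧ AssertiveC (Γ₂ ++ Γ₁) (Clause.subst σ C) π ∧ ¬ HasFalseInstance Γ₁ C) ∨
        (0 < k ∧ (∃ L' π' Γ₂', Γ₂ = .decision L' π' (level (Γ₂ ++ Γ₁)) :: Γ₂') ∧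
          ¬ AssertiveC (Γ₂ ++ Γ₁) (Clause.subst σ C) π ∧
          ¬ Applicable Factorize ⟨Γ₂ ++ Γ₁, N, U, k, .conflict C σ π⟩ ∧
          ¬ HasFalseInstance Γ₁ C)) :
      Backjump ⟨Γ₂ ++ Γ₁, N, U, k, .conflict C σ π⟩ ⟨Γ₁, N, U ∪ {C}, level Γ₁, .top⟩

/-! ### Runs -/

/-- One application of a rule of the calculus. -/
def Step (s s' : State S V) : Prop :=
  Propagate s s' ∨ Decide s s' ∨ Conflict s s' ∨ Success s s' ∨ Failure s s' ∨
    Skip s s' ∨ Resolve s s' ∨ Factorize s s' ∨ Backjump s s'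

/-- A run from `N`: a finite or infinite sequence of states, each derived from the previous one by
a rule, that starts in a sound state with clause set `N`. -/
structure IsRun (N : Set (FClause S V)) (run : Stream'.Seq (State S V)) : Prop where
  start : ∃ s, run.get? 0 = some s ∧ s.clauses = N ∧ s.Sound
  step : ∀ i s s', run.get? i = some s → run.get? (i + 1) = some s' → Step s s'

/-- The two orders in which a regular run may try the rules of conflict search: both terminal rules
first, or *Failure* first and *Success* last. -/
inductive SearchOrder where
  | successFirst
  | successLast

/-- A conflict search step that respects the order of the rules. -/
def SearchStep : SearchOrder → State S V → State S V → Prop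
  | .successFirst, s, s' =>
      Failure s s' ∨ Success s s' ∨
      (¬ Applicable Failure s ∧ ¬ Applicable Success s ∧
        (Conflict s s' ∨
        (¬ Applicable Conflict s ∧ Propagate s s') ∨
        (¬ Applicable Conflict s ∧ ¬ Applicable Propagate s ∧ Decide s s')))
  | .successLast, s, s' =>
      Failure s s' ∨
      (¬ Applicable Failure s ∧
        (Conflict s s' ∨
        (¬ Applicable Conflict s ∧ Propagate s s') ∨
        (¬ Applicable Conflict s ∧ ¬ Applicable Propagate s ∧ Decide s s') ∨
        (¬ Applicable Conflict s ∧ ¬ Applicable Propagate s ∧ ¬ Applicable Decide s ∧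
          Success s s')))

/-- A conflict resolution step of a regular run: *Backjump* is applied as soon as possible, and to a
regular state. -/
def ResolutionStep (s s' : State S V) : Prop :=
  (Backjump s s' ∧ s'.Regular) ∨
    (¬ Applicable Backjump s ∧ (Skip s s' ∨ Resolve s s' ∨ Factorize s s'))

/-- Regular runs. -/
structure IsRegularRun (o : SearchOrder) (N : Set (FClause S V))
    (run : Stream'.Seq (State S V)) : Prop where
  isRun : IsRun N run
  start_regular : ∀ s, run.get? 0 = some s → s.Regular
  regular_step : ∀ i s s', run.get? i = some s → run.get? (i + 1) = some s' →
    SearchStep o s s' ∨ ResolutionStep s s'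

end

end NRCL

/-! A phase of conflict search followed by conflict resolution is finite, and each Backjump makes
irreversible progress, so a lexicographic measure in six natural numbers decreases at every step.

Progress across phases is counted by profiles: the set of literals of a ground clause together with
the set of its repeated literals. Over a finite signature and domain there are finitely many ground
literals, hence finitely many profiles, although there are infinitely many ground clauses as
multisets. The set of literals alone would be too coarse, since assertiveness depends on whether the
top-level literal is repeated; higher multiplicities are irrelevant.

A learned clause other than ⊥ has a ground instance with a new profile. If the instance is
assertive, an old clause of the same profile would already have been propagating before the last
decision, contrary to exhaustive propagation (`GoodTrail.profile_notMem_of_assertive`). If Backjump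
happens at a decision without assertiveness and without Factorize being applicable, an old clause of
the same profile would either have been false before the decision or have blocked it
(`GoodTrail.profile_notMem_of_decision`, with `applicable_factorize` excluding repeated literals).
Once ⊥ is present, the rank component takes over.

Within a phase, Propagate and Decide reduce the number of undefined ground literals, and Conflict
moves from search to resolution. There Skip shortens the trail, Resolve reduces the number of
literals overlapping with the last assignment (`Resolve.overlap_and_conflict`), and Factorize
shortens the clause. These arguments rest on `State.Invariant`, which a regular state has and which
every step other than Backjump preserves; after Backjump it is recovered from regularity. -/

namespace NRCL

section

variable {S : Signature.{u, v}} {V : Type w}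

/-! ### Substitutions and groundings -/

/-- The grounding substitution that first applies `σ`, then `δ`. -/
def groundComp (σ : Subst S V) (δ : V → S.Const) : V → S.Const := fun x => (σ x).ground δ

/-- A grounding substitution as a substitution. -/
def groundSubst (δ : V → S.Const) : Subst S V := fun x => .const (δ x)

theorem Tm.subst_subst (σ τ : Subst S V) (t : Tm S.Const V) :
    (t.subst σ).subst τ = t.subst (comp σ τ) := by
  cases t <;> rfl

theorem Tm.ground_subst (σ : Subst S V) (δ : V → S.Const) (t : Tm S.Const V) :
    (t.subst σ).ground δ = t.ground (groundComp σ δ) := by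
  cases t <;> rfl

theorem Tm.subst_groundSubst (δ : V → S.Const) (t : Tm S.Const V) :
    t.subst (groundSubst δ) = .const (t.ground δ) := by
  cases t <;> rfl

theorem Tm.ground_congr {δ δ' : V → S.Const} (t : Tm S.Const V) (h : ∀ x ∈ t.vars, δ x = δ' x) :
    t.ground δ = t.ground δ' := by
  cases t with
  | var x => exact h x rfl
  | const c => rfl

theorem Tm.vars_finite (t : Tm S.Const V) : t.vars.Finite := by
  cases t <;> simp [Tm.vars]

theorem Lit.ground_subst (σ : Subst S V) (δ : V → S.Const) (L : FLit S V) :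
    (L.subst σ).ground δ = L.ground (groundComp σ δ) := by
  simp [Lit.subst, Lit.ground, Lit.map, Tm.ground_subst]

theorem Lit.subst_subst (σ τ : Subst S V) (L : FLit S V) :
    (L.subst σ).subst τ = L.subst (comp σ τ) := by
  simp [Lit.subst, Lit.map, Tm.subst_subst]

theorem Lit.ground_neg (δ : V → S.Const) (L : FLit S V) : L.neg.ground δ = (L.ground δ).neg := rfl

@[simp] theorem Lit.neg_neg {T : Type*} (l : Lit S T) : l.neg.neg = l := by
  simp [Lit.neg]

theorem Lit.ground_congr {δ δ' : V → S.Const} (L : FLit S V) (h : ∀ x ∈ L.vars, δ x = δ' x) :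
    L.ground δ = L.ground δ' := by
  have : ∀ i, (L.atom.args i).ground δ = (L.atom.args i).ground δ' :=
    fun i => Tm.ground_congr _ fun x hx => h x ⟨i, hx⟩
  simp [Lit.ground, Lit.map, this]

theorem Lit.vars_finite (L : FLit S V) : L.vars.Finite := by
  have : L.vars = ⋃ i, (L.atom.args i).vars := by ext; simp [Lit.vars]
  rw [this]
  exact Set.finite_iUnion fun i => Tm.vars_finite _

theorem Lit.subst_groundSubst_eq {δ : V → S.Const} {L M : FLit S V}
    (h : L.ground δ = M.ground δ) : L.subst (groundSubst δ) = M.subst (groundSubst δ) := by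
  have : ∀ L : FLit S V, L.subst (groundSubst δ) = (L.ground δ).map Tm.const := fun L => by
    simp [Lit.subst, Lit.map, Lit.ground, Tm.subst_groundSubst]
  rw [this, this, h]

theorem Clause.ground_subst (σ : Subst S V) (δ : V → S.Const) (C : FClause S V) :
    Clause.ground δ (Clause.subst σ C) = Clause.ground (groundComp σ δ) C := by
  simp [Clause.subst, Clause.ground, Lit.ground_subst]

theorem Clause.vars_finite (C : FClause S V) : (Clause.vars C).Finite := by
  classical
  have : Clause.vars C = ⋃ L ∈ C.toFinset, Lit.vars L := by ext; simp [Clause.vars]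
  rw [this]
  exact Set.Finite.biUnion (Finset.finite_toSet _) fun L _ => Lit.vars_finite L

theorem Constraint.lvars_finite (π : Constraint S V) : π.lvars.Finite := by
  classical
  have : π.lvars = ⋃ d ∈ {d | d ∈ π}, ⋃ i, (d.lhs i).vars := by
    ext; simp [Constraint.lvars]
  rw [this]
  exact Set.Finite.biUnion (List.finite_toSet π) fun d _ =>
    Set.finite_iUnion fun i => Tm.vars_finite _

theorem Constraint.solution_subst (σ : Subst S V) (δ : V → S.Const) (π : Constraint S V) :
    (π.subst σ).Solution δ ↔ π.Solution (groundComp σ δ) := by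
  simp [Constraint.Solution, Constraint.subst, Diseq.subst, Tm.ground_subst]

theorem Constraint.solution_and (π π' : Constraint S V) (δ : V → S.Const) :
    (π.and π').Solution δ ↔ π.Solution δ ∧ π'.Solution δ := by
  change (∀ d ∈ π ++ π', _) ↔ _
  simp only [List.mem_append, or_imp, forall_and]
  rfl

theorem Constraint.solution_congr {δ δ' : V → S.Const} {π : Constraint S V}
    (h : ∀ x ∈ π.lvars, δ x = δ' x) (hδ : π.Solution δ) : π.Solution δ' := by
  rintro d hd ⟨ε, hε⟩
  refine hδ d hd ⟨ε, fun i => ?_⟩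
  rw [← hε i]
  exact Tm.ground_congr _ fun x hx => h x ⟨d, hd, i, hx⟩

theorem Constraint.solution_nil (δ : V → S.Const) : Constraint.Solution ([] : Constraint S V) δ := by
  intro d hd
  cases hd

theorem jointConstraint_solution (ρ : V → V) (a : Assignment S V) (π : Constraint S V)
    (η : Subst S V) (δ : V → S.Const) :
    (jointConstraint ρ a π η).Solution δ ↔
      π.Solution (groundComp η δ) ∧ a.constr.Solution (groundComp η δ ∘ ρ) := by
  rw [jointConstraint, Constraint.solution_and, Constraint.solution_subst,
    Constraint.solution_subst, Constraint.solution_subst]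
  rfl

theorem Lit.ground_rename (ρ : V → V) (δ : V → S.Const) (L : FLit S V) :
    (L.subst (renameSubst ρ)).ground δ = L.ground (δ ∘ ρ) :=
  Lit.ground_subst _ _ _

theorem gndClause_subset_gnd (C : FClause S V) (σ : Subst S V) (π : Constraint S V) :
    gndClause (Clause.subst σ C) π ⊆ gnd C := by
  rintro G ⟨δ, -, rfl⟩
  exact ⟨groundComp σ δ, (Clause.ground_subst _ _ _).symm⟩

theorem gndClause_groundSubst (C : FClause S V) (δ : V → S.Const) {G : GClause S}
    (h : G ∈ gndClause (Clause.subst (groundSubst δ) C) []) : G = Clause.ground δ C := by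
  obtain ⟨ε, -, rfl⟩ := h
  exact Clause.ground_subst _ _ _

/-! ### Most general unifiers -/

open Classical in
/-- A representative of a class of terms: a constant if there is one. -/
noncomputable def representative {s : Setoid (Tm S.Const V)} (q : Quotient s) : Tm S.Const V :=
  if h : ∃ c, Quotient.mk s (.const c) = q then .const h.choose else q.out

theorem mk_representative {s : Setoid (Tm S.Const V)} (q : Quotient s) :
    Quotient.mk s (representative q) = q := by
  unfold representative
  split_ifs with h
  · exact h.choose_spec
  · exact Quotient.out_eq q

/-- Corresponding arguments of two literals in `A`. -/
def ArgPair (A : Set (FLit S V)) (s t : Tm S.Const V) : Prop :=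
  ∃ (b : Bool) (p : S.Pred) (f g : Fin (S.arity p) → Tm S.Const V) (i : Fin (S.arity p)),
    (⟨b, ⟨p, f⟩⟩ : FLit S V) ∈ A ∧ (⟨b, ⟨p, g⟩⟩ : FLit S V) ∈ A ∧ s = f i ∧ t = g i

/-- Without function symbols, unification amounts to closing the pairs of corresponding arguments
under equivalence. Every unifier is constant on the classes, so a unifiable set never identifies two
distinct constants. Sending each variable to the representative of its class, a constant if there is
one, is most general. -/
theorem exists_isMGU {A : Set (FLit S V)} {θ : Subst S V}
    (hθ : ∀ L ∈ A, ∀ M ∈ A, L.subst θ = M.subst θ) : ∃ η, IsMGU η A := by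
  let s : Setoid (Tm S.Const V) := Relation.EqvGen.setoid (ArgPair A)
  have unif : ∀ θ : Subst S V, (∀ L ∈ A, ∀ M ∈ A, L.subst θ = M.subst θ) →
      ∀ t t', Quotient.mk s t = Quotient.mk s t' → t.subst θ = t'.subst θ := by
    intro θ hθ t t' h
    have h' : Relation.EqvGen (ArgPair A) t t' := Quotient.exact h
    clear h
    induction h' with
    | rel t t' h =>
      obtain ⟨b, p, f, g, i, hf, hg, rfl, rfl⟩ := h
      have := hθ _ hf _ hg
      simp only [Lit.subst, Lit.map, Lit.mk.injEq, Atom.mk.injEq, heq_eq_eq, true_and] at this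
      exact congrFun this i
    | refl t => rfl
    | symm t t' _ ih => exact ih.symm
    | trans t t' t'' _ _ ih₁ ih₂ => exact ih₁.trans ih₂
  have const_rep : ∀ c : S.Const, representative (Quotient.mk s (.const c)) = .const c := by
    intro c
    have h : ∃ d, Quotient.mk s (.const d) = Quotient.mk s (.const c) := ⟨c, rfl⟩
    rw [representative, dif_pos h]
    exact unif θ hθ _ _ h.choose_spec
  let η : Subst S V := fun x => representative (Quotient.mk s (.var x))
  have subst_η : ∀ t : Tm S.Const V, t.subst η = representative (Quotient.mk s t) := by
    intro t
    cases t with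
    | var x => rfl
    | const c => exact (const_rep c).symm
  -- Any unifier `θ` factors through `η` with `θ` itself as second factor, because `θ` agrees on a
  -- variable and its representative.
  refine ⟨η, fun L hL M hM => ?_, fun θ hθ => ⟨θ, funext fun x => ?_⟩⟩
  · have h := hθ L hL M hM
    obtain ⟨b, p, f⟩ := L
    obtain ⟨b', p', g⟩ := M
    simp only [Lit.subst, Lit.map, Lit.mk.injEq, Atom.mk.injEq] at h
    obtain ⟨rfl, rfl, -⟩ := h
    have : ∀ i, (f i).subst η = (g i).subst η := fun i => by
      rw [subst_η, subst_η]
      exact congrArg _ (Quotient.sound (Relation.EqvGen.rel _ _ ⟨b, p, f, g, i, hL, hM, rfl, rfl⟩))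
    simp [Lit.subst, Lit.map, this]
  · exact (unif θ hθ _ _ (mk_representative (Quotient.mk s (.var x)))).symm

/-- Literals with a common ground instance have a most general unifier, through which the grounding
factors. -/
theorem exists_isMGU_of_ground {A : Set (FLit S V)} {ε : V → S.Const}
    (h : ∀ L ∈ A, ∀ M ∈ A, L.ground ε = M.ground ε) :
    ∃ η δ, IsMGU η A ∧ groundComp η δ = ε := by
  have hθ : ∀ L ∈ A, ∀ M ∈ A, L.subst (groundSubst ε) = M.subst (groundSubst ε) :=
    fun L hL M hM => Lit.subst_groundSubst_eq (h L hL M hM)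
  obtain ⟨η, hη⟩ := exists_isMGU hθ
  obtain ⟨τ, hτ⟩ := hη.2 _ hθ
  refine ⟨η, groundComp τ ε, hη, funext fun x => ?_⟩
  have := congrArg (Tm.ground ε) (congrFun hτ x)
  change ε x = ((η x).subst τ).ground ε at this
  rw [this, Tm.ground_subst]
  rfl

/-! ### Renaming apart -/

theorem Assignment.lit_vars_subset (a : Assignment S V) : a.lit.vars ⊆ a.vars := by
  intro x hx
  cases a with
  | decision L π i => exact Or.inl hx
  | deduced L σ π C => exact Or.inl ⟨L.subst σ, by simp [Clause.subst], hx⟩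

theorem Assignment.constr_lvars_subset (a : Assignment S V) : a.constr.lvars ⊆ a.vars := by
  intro x hx
  cases a <;> exact Or.inr hx

theorem exists_apart [Infinite V] (a : Assignment S V) (C : FClause S V) (σ : Subst S V)
    (π : Constraint S V) : ∃ ρ, Apart ρ a C σ π := by
  -- Only finitely many variables have to be avoided, so all of `V` injects into the rest.
  set B := Clause.vars (Clause.subst σ C) ∪ π.lvars with hB
  have hfin : B.Finite := (Clause.vars_finite _).union (Constraint.lvars_finite _)
  have hcard : Cardinal.mk (Bᶜ : Set V) = Cardinal.mk V :=
    Cardinal.mk_compl_of_infinite B (hfin.lt_aleph0.trans_le (Cardinal.aleph0_le_mk V))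
  obtain ⟨e⟩ := Cardinal.eq.1 hcard.symm
  refine ⟨fun x => e x, fun x y h => e.injective (Subtype.ext h), ?_⟩
  rw [Set.disjoint_left]
  rintro _ ⟨x, -, rfl⟩ h
  exact (e x).2 h

theorem Apart.exists_joint_grounding {ρ : V → V} {a : Assignment S V} {C : FClause S V}
    {σ : Subst S V} {π : Constraint S V} (hρ : Apart ρ a C σ π) (δ δ' : V → S.Const) :
    ∃ ε : V → S.Const, (∀ x ∈ Clause.vars (Clause.subst σ C) ∪ π.lvars, δ x = ε x) ∧
      ∀ x ∈ a.vars, δ' x = ε (ρ x) := by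
  classical
  refine ⟨fun y => if h : ∃ x ∈ a.vars, ρ x = y then δ' h.choose else δ y, fun x hx => ?_,
    fun x hx => ?_⟩
  · have : ¬ ∃ y ∈ a.vars, ρ y = x := fun ⟨y, hy, hyx⟩ =>
      Set.disjoint_left.1 hρ.2 ⟨y, hy, hyx⟩ hx
    simp only [dif_neg this]
  · have h : ∃ y ∈ a.vars, ρ y = ρ x := ⟨x, hx, rfl⟩
    simp only [dif_pos h]
    rw [hρ.1 h.choose_spec.2]

/-- If a constrained clause and an assignment have solutions `δ` and `δ'`, then, after renaming,
they have a joint solution with the same instances. -/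
theorem exists_apart_grounding [Infinite V] (a : Assignment S V) (C : FClause S V) (σ : Subst S V)
    (π : Constraint S V) {δ δ' : V → S.Const} (hδ : π.Solution δ) (hδ' : a.constr.Solution δ') :
    ∃ ρ ε, Apart ρ a C σ π ∧ π.Solution ε ∧ a.constr.Solution (ε ∘ ρ) ∧
      (∀ L ∈ C, (L.subst σ).ground ε = (L.subst σ).ground δ) ∧
      (a.lit.subst (renameSubst ρ)).ground ε = a.lit.ground δ' := by
  obtain ⟨ρ, hρ⟩ := exists_apart a C σ π
  obtain ⟨ε, h₁, h₂⟩ := hρ.exists_joint_grounding δ δ'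
  refine ⟨ρ, ε, hρ, Constraint.solution_congr (fun x hx => h₁ x (Or.inr hx)) hδ,
    Constraint.solution_congr (fun x hx => h₂ x (a.constr_lvars_subset hx)) hδ',
    fun L hL => (Lit.ground_congr _ fun x hx =>
      h₁ x (Or.inl ⟨_, Multiset.mem_map_of_mem _ hL, hx⟩)).symm, ?_⟩
  rw [Lit.ground_rename]
  exact (Lit.ground_congr _ fun x hx => h₂ x (a.lit_vars_subset hx)).symm


/-! ### Trails -/

/-- Being defined is invariant under complement, so undefinedness extends from the covered literals
to all literals that the assignment defines. -/
theorem Assignment.Defines.not_mem_of_undefined {a : Assignment S V} {Γ : Trail S V} {l : GLit S}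
    (hΓ : UndefinedL Γ a.lit a.constr) (h : a.Defines l) : ¬ DefinedLit Γ l := by
  rintro ⟨b, hb, hbl⟩
  rcases h with h | h
  · exact hΓ l h ⟨b, hb, hbl⟩
  · exact hΓ l.neg h ⟨b, hb, by simpa [Assignment.Defines] using hbl.symm⟩

theorem FalseLit.mono {Γ Γ' : Trail S V} (h : Γ ⊆ Γ') {l : GLit S} (hl : FalseLit Γ l) :
    FalseLit Γ' l :=
  let ⟨a, ha, hal⟩ := hl
  ⟨a, h ha, hal⟩

theorem FalseLit.defined {Γ : Trail S V} {l : GLit S} (hl : FalseLit Γ l) : DefinedLit Γ l :=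
  let ⟨a, ha, hal⟩ := hl
  ⟨a, ha, Or.inr hal⟩

theorem HasFalseInstance.mono {Γ Γ' : Trail S V} (h : Γ ⊆ Γ') {C : FClause S V}
    (hC : HasFalseInstance Γ C) : HasFalseInstance Γ' C :=
  let ⟨G, hG, hGf⟩ := hC
  ⟨G, hG, fun l hl => (hGf l hl).mono h⟩

theorem level_eq_zero_or_mem (Γ : Trail S V) : level Γ = 0 ∨ level Γ ∈ decisionLabels Γ := by
  induction Γ with
  | nil => exact Or.inl rfl
  | cons a Γ ih =>
    cases a with
    | decision L π i => exact Or.inr (List.mem_cons_self ..)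
    | deduced L σ π C => exact ih

theorem decisionLabels_append (Γ₂ Γ₁ : Trail S V) :
    decisionLabels (Γ₂ ++ Γ₁) = decisionLabels Γ₂ ++ decisionLabels Γ₁ := by
  induction Γ₂ with
  | nil => rfl
  | cons a Γ ih =>
    cases a with
    | decision L π i => exact congrArg (i :: ·) ih
    | deduced L σ π C => exact ih

theorem HasLevel.cons {Γ : Trail S V} {l : GLit S} {n : ℕ} (a : Assignment S V)
    (h : HasLevel Γ l n) : HasLevel (a :: Γ) l n := by
  obtain ⟨Γ₂, b, Γ₁, rfl, hb, hn⟩ := h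
  exact ⟨a :: Γ₂, b, Γ₁, rfl, hb, hn⟩

theorem HasLevel.head {Γ : Trail S V} {l : GLit S} {a : Assignment S V} (h : a.Defines l) :
    HasLevel (a :: Γ) l (level (a :: Γ)) :=
  ⟨[], a, Γ, rfl, h, rfl⟩

theorem hasLevel_cons {Γ : Trail S V} {a : Assignment S V} {l : GLit S} {n : ℕ}
    (h : HasLevel (a :: Γ) l n) : (a.Defines l ∧ level (a :: Γ) = n) ∨ HasLevel Γ l n := by
  obtain ⟨Γ₂, b, Γ₁, hΓ, hb, hn⟩ := h
  cases Γ₂ with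
  | nil =>
    obtain ⟨rfl, rfl⟩ := List.cons.inj hΓ
    exact Or.inl ⟨hb, hn⟩
  | cons c Γ₂ =>
    obtain ⟨rfl, rfl⟩ := List.cons.inj hΓ
    exact Or.inr ⟨Γ₂, b, Γ₁, rfl, hb, hn⟩

theorem HasLevel.mem_labels {Γ : Trail S V} {l : GLit S} {n : ℕ} (hn : 0 < n)
    (h : HasLevel Γ l n) : n ∈ decisionLabels Γ := by
  obtain ⟨Γ₂, a, Γ₁, rfl, -, rfl⟩ := h
  rw [decisionLabels_append]
  exact List.mem_append_right _ ((level_eq_zero_or_mem _).resolve_left hn.ne')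

/-! ### Trails of regular states -/

/-- The properties of the trails of regular states that do not depend on the state indicator. -/
inductive GoodTrail (N U : Set (FClause S V)) : Trail S V → Prop
  | nil : GoodTrail N U []
  | decision (L : FLit S V) (π : Constraint S V) (i : ℕ) (Γ : Trail S V)
      (tail : GoodTrail N U Γ) (no_false : ∀ C ∈ N ∪ U, ¬ HasFalseInstance Γ C)
      (undefined : UndefinedL Γ L π) (not_blocked : ∀ C ∈ N ∪ U, ¬ Blocked Γ L π C)
      (labels : ∀ j ∈ decisionLabels Γ, j < i)
      (exhausted : ¬ ∃ L' σ' π' C', PropagateCond (N ∪ U) Γ L' σ' π' C') :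
      GoodTrail N U (.decision L π i :: Γ)
  | deduced (L : FLit S V) (σ : Subst S V) (π : Constraint S V) (C : FClause S V)
      (Γ : Trail S V) (tail : GoodTrail N U Γ)
      (no_false : ∀ C ∈ N ∪ U, ¬ HasFalseInstance Γ C)
      (undefined : UndefinedL Γ (L.subst σ) π) (reason : FalseC Γ (Clause.subst σ C) π) :
      GoodTrail N U (.deduced L σ π C :: Γ)

variable {N U : Set (FClause S V)}

theorem GoodTrail.tail_of_cons {a : Assignment S V} {Γ : Trail S V}
    (h : GoodTrail N U (a :: Γ)) : GoodTrail N U Γ := by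
  cases h <;> assumption

theorem GoodTrail.undefined_of_cons {a : Assignment S V} {Γ : Trail S V}
    (h : GoodTrail N U (a :: Γ)) : UndefinedL Γ a.lit a.constr := by
  cases h <;> assumption

/-- Regularity excludes false instances only for the trail without its last element; falsity is
monotone in the trail, so all shorter parts inherit this. -/
theorem State.Regular.goodTrail {s : State S V} (h : s.Regular) :
    GoodTrail s.clauses s.learned s.trail := by
  have main : ∀ Γ Γ₂ : Trail S V, s.trail = Γ₂ ++ Γ → GoodTrail s.clauses s.learned Γ := by
    intro Γ
    induction Γ with
    | nil => exact fun _ _ => .nil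
    | cons a Γ ih =>
      intro Γ₂ hs
      have hno : ∀ C ∈ s.clauses ∪ s.learned, ¬ HasFalseInstance Γ C := by
        intro C hC hf
        cases Γ₂ with
        | nil => exact h.no_false _ _ hs C hC hf
        | cons b Γ₂ =>
          exact h.no_false _ _ hs C hC
            (hf.mono fun x hx => List.mem_append_right _ (List.mem_cons_of_mem _ hx))
      have htail := ih (Γ₂ ++ [a]) (by simpa using hs)
      cases a with
      | decision L π i =>
        have hc := h.sound.decision_cond _ _ _ _ _ hs
        refine .decision L π i Γ htail hno hc.1 hc.2.1 ?_ (h.propagate_exhausted _ _ _ _ _ hs)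
        have hord := h.sound.decision_order
        rw [hs, decisionLabels_append] at hord
        exact (List.pairwise_cons.1 (List.pairwise_append.1 hord).2.1).1
      | deduced L σ π C =>
        have hc := h.sound.deduced_cond _ _ _ _ _ _ hs
        exact .deduced L σ π C Γ htail hno hc.2.2.1 hc.2.1
  exact main _ [] rfl

/-- The trail before the last decision: literals of top level are undefined there, and false
literals of lower level are false there. -/
theorem GoodTrail.exists_before_last_decision {Γ : Trail S V} (h : GoodTrail N U Γ)
    (hpos : 0 < level Γ) :
    ∃ Γ' ⊆ Γ, (¬ ∃ L σ π C, PropagateCond (N ∪ U) Γ' L σ π C) ∧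
      (∀ l, HasLevel Γ l (level Γ) → ¬ DefinedLit Γ' l) ∧
      ∀ l, FalseLit Γ l → ¬ HasLevel Γ l (level Γ) → FalseLit Γ' l := by
  induction h with
  | nil => exact absurd hpos (lt_irrefl 0)
  | decision L π i Γ _ _ undefined _ labels exhausted _ =>
    -- Earlier annotations are smaller than `i`, so only the decision itself can give a literal
    -- level `i`.
    refine ⟨Γ, List.subset_cons_self _ _, exhausted, fun l hl => ?_, fun l hl hnl => ?_⟩
    · rcases hasLevel_cons hl with ⟨hdef, -⟩ | hl
      · exact Assignment.Defines.not_mem_of_undefined (a := .decision L π i) undefined hdef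
      · exact absurd (labels _ (hl.mem_labels hpos)) (lt_irrefl i)
    · obtain ⟨a, ha, hal⟩ := hl
      rcases List.mem_cons.1 ha with rfl | ha
      · exact absurd (HasLevel.head (Or.inr hal)) hnl
      · exact ⟨a, ha, hal⟩
  | deduced L σ π C Γ _ _ undefined _ ih =>
    obtain ⟨Γ', hsub, hex, htop, hlow⟩ := ih hpos
    refine ⟨Γ', fun x hx => List.mem_cons_of_mem _ (hsub hx), hex, fun l hl => ?_,
      fun l hl hnl => ?_⟩
    · rcases hasLevel_cons hl with ⟨hdef, -⟩ | hl
      · rintro ⟨a, ha, hal⟩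
        exact Assignment.Defines.not_mem_of_undefined (a := .deduced L σ π C) undefined hdef
          ⟨a, hsub ha, hal⟩
      · exact htop l hl
    · obtain ⟨a, ha, hal⟩ := hl
      rcases List.mem_cons.1 ha with rfl | ha
      · exact absurd (HasLevel.head (Or.inr hal)) hnl
      · exact hlow l ⟨a, ha, hal⟩ fun h => hnl (h.cons _)

/-! ### Profiles of ground clauses -/

/-- The literals of a ground clause, and its literals with several occurrences. -/
def profile (G : GClause S) : Set (GLit S) × Set (GLit S) :=
  ({l | l ∈ G}, {l | l ::ₘ {l} ≤ G})

/-- The profiles of the ground instances of a clause set. -/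
def profiles (M : Set (FClause S V)) : Set (Set (GLit S) × Set (GLit S)) :=
  {p | ∃ C ∈ M, ∃ G ∈ gnd C, profile G = p}

theorem mem_iff_of_profile_eq {G G' : GClause S} (h : profile G = profile G') (l : GLit S) :
    l ∈ G ↔ l ∈ G' :=
  Set.ext_iff.1 (congrArg Prod.fst h) l

theorem double_le_iff_of_profile_eq {G G' : GClause S} (h : profile G = profile G') (l : GLit S) :
    l ::ₘ {l} ≤ G ↔ l ::ₘ {l} ≤ G' :=
  Set.ext_iff.1 (congrArg Prod.snd h) l

theorem FalseG.of_profile_eq {Γ : Trail S V} {G G' : GClause S} (h : profile G = profile G')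
    (hG : FalseG Γ G) : FalseG Γ G' :=
  fun l hl => hG l ((mem_iff_of_profile_eq h l).2 hl)

/-- A literal with a single occurrence has a single occurrence in clauses of the same profile. -/
theorem exists_cons_of_profile_eq {l : GLit S} {G D : GClause S}
    (h : profile (l ::ₘ G) = profile D) (hl : l ∉ G) : ∃ D', D = l ::ₘ D' ∧ ∀ x ∈ D', x ∈ G := by
  obtain ⟨D', rfl⟩ := Multiset.exists_cons_of_mem
    ((mem_iff_of_profile_eq h l).1 (Multiset.mem_cons_self l G))
  refine ⟨D', rfl, fun x hx => ?_⟩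
  rcases Multiset.mem_cons.1
    ((mem_iff_of_profile_eq h x).2 (Multiset.mem_cons_of_mem hx)) with rfl | hxG
  · have := (double_le_iff_of_profile_eq h x).2 (Multiset.cons_le_cons x (by simpa using hx))
    exact absurd (by simpa using (Multiset.cons_le_cons_iff x).1 this) hl
  · exact hxG

theorem Clause.exists_of_ground_eq_cons {δ : V → S.Const} {C : FClause S V} {l : GLit S}
    {G : GClause S} (h : Clause.ground δ C = l ::ₘ G) :
    ∃ L C', C = L ::ₘ C' ∧ L.ground δ = l ∧ Clause.ground δ C' = G := by
  classical
  obtain ⟨L, hL, hl, hG⟩ := (Multiset.map_eq_cons _ _ _ _).2 h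
  exact ⟨L, C.erase L, (Multiset.cons_erase hL).symm, hl, hG⟩

/-- An assertive clause has a profile that is new to the clause set: otherwise *Propagate* would
have been applicable before the last decision. -/
theorem GoodTrail.profile_notMem_of_assertive {Γ : Trail S V} (h : GoodTrail N U Γ)
    (hpos : 0 < level Γ) {G : GClause S} (hG : AssertiveG Γ G) :
    profile G ∉ profiles (N ∪ U) := by
  rintro ⟨D, hD, _, ⟨δ, rfl⟩, hprof⟩
  obtain ⟨Γ', -, hex, htop, hlow⟩ := h.exists_before_last_decision hpos
  obtain ⟨hfalse, l, G', rfl, hl, hG'⟩ := hG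
  obtain ⟨D', hD', hsub⟩ := exists_cons_of_profile_eq hprof.symm fun hmem => hG' l hmem hl
  obtain ⟨L, E, rfl, rfl, rfl⟩ := Clause.exists_of_ground_eq_cons hD'
  have hL : ∀ ε, (L.subst (groundSubst δ)).ground ε = L.ground δ := fun ε => Lit.ground_subst _ _ _
  -- A ground closure with the trivial constraint propagates exactly one ground literal.
  refine hex ⟨L, groundSubst δ, [], E, hD, fun G hG => ?_, ?_, _, δ,
    Constraint.solution_nil _, rfl⟩
  · rw [gndClause_groundSubst _ _ hG]
    intro x hx
    exact hlow x (hfalse x (Multiset.mem_cons_of_mem (hsub x hx))) (hG' x (hsub x hx))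
  · rintro _ ⟨ε, -, rfl⟩
    rw [hL]
    exact htop _ hl

/-- If the last element of the trail is a decision, then a false clause that is not assertive and
does not contain several occurrences of a literal made false by the decision has a profile that is
new to the clause set: otherwise the decision would have been blocked. -/
theorem GoodTrail.profile_notMem_of_decision {L : FLit S V} {π : Constraint S V} {i : ℕ}
    {Γ : Trail S V} (h : GoodTrail N U (.decision L π i :: Γ)) (hi : 0 < i) {G : GClause S}
    (hfalse : FalseG (.decision L π i :: Γ) G) (hassert : ¬ AssertiveG (.decision L π i :: Γ) G)
    (hdouble : ∀ l, l.neg ∈ gndLit L π → ¬ l ::ₘ {l} ≤ G) :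
    profile G ∉ profiles (N ∪ U) := by
  rintro ⟨D, hD, _, hgnd, hprof⟩
  cases h with
  | decision _ _ _ _ _ no_false undefined not_blocked labels _ =>
  -- If the decision is not needed to falsify `G`, then `D` had a false instance before it.
  by_cases hall : FalseG Γ G
  · exact no_false D hD ⟨_, hgnd, hall.of_profile_eq hprof.symm⟩
  have hcov : ∀ l ∈ G, HasLevel (.decision L π i :: Γ) l i → l.neg ∈ gndLit L π := by
    intro l hl hlev
    rcases hasLevel_cons hlev with ⟨hdef, -⟩ | hlev
    · have hnd := Assignment.Defines.not_mem_of_undefined (a := .decision L π i) undefined hdef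
      obtain ⟨a, ha, hal⟩ := hfalse l hl
      rcases List.mem_cons.1 ha with rfl | ha
      · exact hal
      · exact absurd ⟨a, ha, Or.inr hal⟩ hnd
    · exact absurd (labels _ (hlev.mem_labels hi)) (lt_irrefl i)
  obtain ⟨l, hl, hnl⟩ : ∃ l ∈ G, ¬ FalseLit Γ l := by
    simpa [FalseG] using hall
  have hlcov : l.neg ∈ gndLit L π := by
    obtain ⟨a, ha, hal⟩ := hfalse l hl
    rcases List.mem_cons.1 ha with rfl | ha
    · exact hal
    · exact absurd ⟨a, ha, hal⟩ hnl
  obtain ⟨G', rfl⟩ := Multiset.exists_cons_of_mem hl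
  -- Failure of assertiveness yields a second top-level occurrence, and `hdouble` makes it a
  -- different literal.
  obtain ⟨l', hl', hlev⟩ : ∃ l' ∈ G', HasLevel (.decision L π i :: Γ) l' i := by
    by_contra hno
    push Not at hno
    exact hassert ⟨hfalse, l, G', rfl, HasLevel.head (Or.inr hlcov), hno⟩
  have hl'cov := hcov l' (Multiset.mem_cons_of_mem hl') hlev
  have hne : l ≠ l' := by
    rintro rfl
    exact hdouble l hlcov (Multiset.cons_le_cons l (by simpa using hl'))
  refine not_blocked D hD ⟨_, hgnd, l, (mem_iff_of_profile_eq hprof l).2 hl, l',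
    (mem_iff_of_profile_eq hprof l').2 (Multiset.mem_cons_of_mem hl'), ?_, undefined, hlcov,
    hl'cov, hne⟩
  -- Blocking is stated with the annotation `level Γ + 1` instead of `i`; coverage does not depend
  -- on the annotation.
  intro x hx
  obtain ⟨a, ha, hax⟩ := hfalse.of_profile_eq hprof.symm x hx
  rcases List.mem_cons.1 ha with rfl | ha
  · exact ⟨_, List.mem_cons_self .., hax⟩
  · exact ⟨a, List.mem_cons_of_mem _ ha, hax⟩

/-! ### Overlaps of the conflict clause with the last element of the trail -/

/-- A ground coincidence lifts to a most general unifier with a nonempty joint constraint. This is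
exactly what the side condition of Skip forbids. -/
theorem exists_overlap [Infinite V] (a : Assignment S V) {C : FClause S V} {σ : Subst S V}
    {π : Constraint S V} {δ : V → S.Const} (hδ : π.Solution δ) {L : FLit S V} (hL : L ∈ C)
    (hcov : ((L.subst σ).ground δ).neg ∈ a.covers) :
    ∃ ρ η, Apart ρ a C σ π ∧
      IsMGU η {a.lit.subst (renameSubst ρ), (L.subst σ).neg} ∧
      (gndClause (Clause.subst η (Clause.subst σ C)) (jointConstraint ρ a π η)).Nonempty := by
  obtain ⟨δ', hδ', hl⟩ := hcov
  obtain ⟨ρ, ε, hρ, hε, hε', hεC, hεa⟩ := exists_apart_grounding a C σ π hδ hδ'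
  have heq : (a.lit.subst (renameSubst ρ)).ground ε = (L.subst σ).neg.ground ε := by
    rw [hεa, Lit.ground_neg, hεC L hL, hl]
  obtain ⟨η, δ₁, hη, rfl⟩ := exists_isMGU_of_ground (ε := ε)
    (A := {a.lit.subst (renameSubst ρ), (L.subst σ).neg}) (by
      rintro M (rfl | rfl) M' (rfl | rfl) <;> first | rfl | exact heq | exact heq.symm)
  exact ⟨ρ, η, hρ, hη, _, δ₁, (jointConstraint_solution ..).2 ⟨hε, hε'⟩, rfl⟩

/-- Two occurrences of one ground literal, falsified by the last assignment, lift to two literals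
that Factorize can merge. -/
theorem applicable_factorize [Infinite V] (a : Assignment S V) (Γ : Trail S V) (k : ℤ)
    {C : FClause S V} {σ : Subst S V} {π : Constraint S V} {δ : V → S.Const} (hδ : π.Solution δ)
    {l : GLit S} (hl : l ::ₘ {l} ≤ Clause.ground δ (Clause.subst σ C)) (hcov : l.neg ∈ a.covers) :
    Applicable Factorize ⟨a :: Γ, N, U, k, .conflict C σ π⟩ := by
  obtain ⟨G, hG⟩ := Multiset.le_iff_exists_add.1 hl
  rw [Multiset.cons_add, Multiset.singleton_add, Clause.ground_subst] at hG
  obtain ⟨L₁, C₁, rfl, h₁, hG₁⟩ := Clause.exists_of_ground_eq_cons hG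
  obtain ⟨L₂, C₂, rfl, h₂, -⟩ := Clause.exists_of_ground_eq_cons hG₁
  rw [← Lit.ground_subst] at h₁ h₂
  obtain ⟨δ', hδ', hl'⟩ := hcov
  obtain ⟨ρ, ε, hρ, hε, hε', hεC, hεa⟩ := exists_apart_grounding a (L₁ ::ₘ L₂ ::ₘ C₂) σ π hδ hδ'
  have e₁ : (L₁.subst σ).ground ε = l := (hεC L₁ (by simp)).trans h₁
  have e₂ : (L₂.subst σ).ground ε = l := (hεC L₂ (by simp)).trans h₂
  have e₃ : (a.lit.subst (renameSubst ρ)).neg.ground ε = l := by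
    rw [Lit.ground_neg, hεa, hl', Lit.neg_neg]
  have hA : ∀ M ∈ ({L₁.subst σ, L₂.subst σ, (a.lit.subst (renameSubst ρ)).neg} : Set (FLit S V)),
      M.ground ε = l := by
    rintro M (rfl | rfl | rfl)
    exacts [e₁, e₂, e₃]
  obtain ⟨η, δ₁, hη, rfl⟩ := exists_isMGU_of_ground
    fun M hM M' hM' => (hA M hM).trans (hA M' hM').symm
  have hunif : L₁.subst (comp σ η) = L₂.subst (comp σ η) := by
    rw [← Lit.subst_subst, ← Lit.subst_subst]
    exact hη.1 _ (by simp) _ (by simp)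
  have hunif' : ∀ M ∈ ({L₁, L₂} : Set (FLit S V)), ∀ M' ∈ ({L₁, L₂} : Set (FLit S V)),
      M.subst (comp σ η) = M'.subst (comp σ η) := by
    rintro M (rfl | rfl) M' (rfl | rfl) <;> first | rfl | exact hunif | exact hunif.symm
  obtain ⟨η₀, hη₀⟩ := exists_isMGU hunif'
  -- Since `σ` followed by `η` unifies `L₁` and `L₂`, it factors through `η₀`; the factor is the new
  -- closure.
  obtain ⟨τ, hτ⟩ := hη₀.2 _ hunif'
  exact ⟨_, .mk Γ N U k C₂ L₁ L₂ σ π a ρ η η₀ τ _ hρ hη hη₀ (fun x _ => (congrFun hτ x).symm)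
    ⟨_, δ₁, (jointConstraint_solution ..).2 ⟨hε, hε'⟩, rfl⟩ fun _ => Iff.rfl⟩


/-! ### Closures of conflict clauses and the overlap count -/

theorem falseC_subst_iff {Γ : Trail S V} {C : FClause S V} {σ : Subst S V} {π : Constraint S V} :
    FalseC Γ (Clause.subst σ C) π ↔
      ∀ δ, π.Solution δ → ∀ L ∈ C, FalseLit Γ ((L.subst σ).ground δ) := by
  constructor
  · intro h δ hδ L hL
    exact h _ ⟨δ, hδ, rfl⟩ _ (Multiset.mem_map_of_mem _ (Multiset.mem_map_of_mem _ hL))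
  · rintro h _ ⟨δ, hδ, rfl⟩ l hl
    obtain ⟨M, hM, rfl⟩ := Multiset.mem_map.1 hl
    obtain ⟨L, hL, rfl⟩ := Multiset.mem_map.1 hM
    exact h δ hδ L hL

/-- This is how the rule condition on σ* is used: ground instances of the new closure are instances
of the old one, under the grounding composed with `η`. -/
theorem Lit.ground_subst_eq_of_comp {η₀ σs σ η : Subst S V} {L : FLit S V}
    (h : ∀ x ∈ L.vars, (η₀ x).subst σs = (σ x).subst η) (δ : V → S.Const) :
    ((L.subst η₀).subst σs).ground δ = (L.subst σ).ground (groundComp η δ) := by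
  rw [Lit.ground_subst, Lit.ground_subst, Lit.ground_subst]
  refine Lit.ground_congr _ fun x hx => ?_
  have := congrArg (Tm.ground δ) (h x hx)
  rwa [Tm.ground_subst, Tm.ground_subst] at this

/-- Some instance of `(Lσ; π)` is made false by the assignment `a`. -/
def Overlaps (a : Assignment S V) (σ : Subst S V) (π : Constraint S V) (L : FLit S V) : Prop :=
  ∃ δ, π.Solution δ ∧ ((L.subst σ).ground δ).neg ∈ a.covers

open Classical in
/-- The number of literals of a conflict clause that overlap with the last element of the trail. -/
noncomputable def overlapCount : Trail S V → FClause S V → Subst S V → Constraint S V → ℕ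
  | [], _, _, _ => 0
  | a :: _, C, σ, π => C.countP (Overlaps a σ π)

theorem countP_map_le {α β : Type*} (f : α → β) (p : α → Prop) (q : β → Prop) [DecidablePred p]
    [DecidablePred q] (C : Multiset α) (h : ∀ x ∈ C, q (f x) → p x) :
    (C.map f).countP q ≤ C.countP p := by
  induction C using Multiset.induction with
  | empty => simp
  | cons x C ih =>
    have := ih fun y hy => h y (Multiset.mem_cons_of_mem hy)
    have hx := h x (Multiset.mem_cons_self x C)
    rw [Multiset.map_cons, Multiset.countP_cons, Multiset.countP_cons]
    split_ifs <;> first | omega | (exfalso; tauto)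

/-! ### The invariant of regular runs -/

/-- Regularity is given only at the start and after Backjump; this is the part that the steps in
between maintain. The conditions on `k` exempt ⊥ because Failure resets `k` to `0` and keeps the
trail. -/
structure State.Invariant (s : State S V) : Prop where
  trail : GoodTrail s.clauses s.learned s.trail
  labels_le : s.ind ≠ .bot → 0 ≤ s.k → ∀ i ∈ decisionLabels s.trail, (i : ℤ) ≤ s.k
  level_pos : s.ind ≠ .bot → 0 < s.k → 0 < level s.trail
  conflict : ∀ C σ π, s.ind = .conflict C σ π →
    FalseC s.trail (Clause.subst σ C) π ∧ ∃ δ, π.Solution δ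

/-- By counting: there are `k` labels, and each of `1, ..., k` is among them. -/
theorem State.Sound.labels_le {s : State S V} (h : s.Sound) (hk : 0 ≤ s.k) :
    ∀ i ∈ decisionLabels s.trail, (i : ℤ) ≤ s.k := by
  intro i hi
  obtain ⟨n, hn⟩ := Int.eq_ofNat_of_zero_le hk
  have hlen : (decisionLabels s.trail).length = n := by
    have := h.decision_count hk
    omega
  have hsub : Finset.Icc 1 n ⊆ (decisionLabels s.trail).toFinset := by
    intro j hj
    rw [Finset.mem_Icc] at hj
    have := h.decision_unique j hj.1 (by omega)
    rw [List.mem_toFinset]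
    exact List.count_pos_iff.1 (by omega)
  have heq := Finset.eq_of_subset_of_card_le hsub
    ((List.toFinset_card_le _).trans (by simp [hlen]))
  have hi' : i ∈ Finset.Icc 1 n := heq ▸ List.mem_toFinset.2 hi
  rw [Finset.mem_Icc] at hi'
  omega

theorem State.Sound.level_pos {s : State S V} (h : s.Sound) (hk : 0 < s.k) :
    0 < level s.trail := by
  obtain ⟨n, hn⟩ := Int.eq_ofNat_of_zero_le hk.le
  have hmem : n ∈ decisionLabels s.trail := by
    have := h.decision_unique n (by omega) (by omega)
    exact List.count_pos_iff.1 (by omega)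
  -- The labels are ordered, so the most recent one is at least `n`.
  have : ∀ Γ : Trail S V, (decisionLabels Γ).Pairwise (· > ·) → ∀ j ∈ decisionLabels Γ,
      j ≤ level Γ := by
    intro Γ
    induction Γ with
    | nil => intro _ j hj; cases hj
    | cons a Γ ih =>
      cases a with
      | deduced L σ π C => exact ih
      | decision L π i =>
        intro hp j hj
        rcases List.mem_cons.1 hj with rfl | hj
        · exact le_refl _
        · exact ((List.pairwise_cons.1 hp).1 j hj).le
  have := this _ h.decision_order n hmem
  omega

theorem State.Regular.invariant {s : State S V} (h : s.Regular) : s.Invariant where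
  trail := h.goodTrail
  labels_le _ := h.sound.labels_le
  level_pos _ := h.sound.level_pos
  conflict C σ π hs :=
    have ⟨h₁, _, _, δ, hδ, _⟩ := h.sound.conflict C σ π hs
    ⟨h₁, δ, hδ⟩

/-! ### The termination measure -/

section Measure

/-- States are ranked by how close the run is to its end because of a terminal state or of an empty
clause. -/
noncomputable def State.rank (s : State S V) : ℕ :=
  open Classical in
  match s.ind with
  | .bot => 0
  -- Search and resolution share rank 4 as long as ⊥ is absent, since they alternate. With ⊥
  -- present, Backjump goes from 3 to 2, and only Failure or Success can follow.
  | .top => if s.k < 0 then 1 else if 0 ∈ s.clauses ∪ s.learned then 2 else 4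
  | .conflict _ _ _ => if 0 ∈ s.clauses ∪ s.learned then 3 else 4

/-- The measure for a phase of conflict search with the subsequent conflict resolution. -/
noncomputable def State.phaseMeasure (s : State S V) : ℕ ×ₗ ℕ ×ₗ ℕ ×ₗ ℕ :=
  match s.ind with
  | .bot => toLex (0, toLex (0, toLex (0, 0)))
  -- The leading 1 puts search above resolution, so Conflict decreases the measure; the way back by
  -- Backjump is paid for by rank or profiles.
  | .top => toLex (1, toLex ({l | ¬ DefinedLit s.trail l}.ncard, toLex (0, 0)))
  | .conflict C σ π =>
      toLex (0, toLex (s.trail.length, toLex (overlapCount s.trail C σ π, Multiset.card C)))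

/-- The termination measure. -/
noncomputable def State.measure (s : State S V) : ℕ ×ₗ ℕ ×ₗ ℕ ×ₗ ℕ ×ₗ ℕ ×ₗ ℕ :=
  toLex (s.rank, toLex ((profiles (s.clauses ∪ s.learned))ᶜ.ncard, s.phaseMeasure))

variable {s s' : State S V}

theorem State.measure_lt_of_rank (h : s'.rank < s.rank) : s'.measure < s.measure :=
  Prod.Lex.toLex_lt_toLex.2 (Or.inl h)

theorem State.measure_lt_of_phaseMeasure (hr : s'.rank = s.rank)
    (hM : s'.clauses ∪ s'.learned = s.clauses ∪ s.learned)
    (h : s'.phaseMeasure < s.phaseMeasure) : s'.measure < s.measure := by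
  refine Prod.Lex.toLex_lt_toLex.2 (Or.inr ⟨hr, Prod.Lex.toLex_lt_toLex.2 (Or.inr ⟨?_, h⟩)⟩)
  simp only [hM]

end Measure

/-! ### Conflict resolution -/

/-- One overlapping literal is resolved away, and the remaining ones gain no instances. The literals
from the reason are false before the last assignment, which covers only literals undefined there, so
they do not overlap. -/
theorem Resolve.overlap_and_conflict {Γ : Trail S V} {k : ℤ} {D : FClause S V} {σ : Subst S V}
    {π : Constraint S V} {s' : State S V}
    (h : Resolve ⟨Γ, N, U, k, .conflict D σ π⟩ s') (hΓ : GoodTrail N U Γ)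
    (hD : FalseC Γ (Clause.subst σ D) π) :
    ∃ D' σ' π', s' = ⟨Γ, N, U, k, .conflict D' σ' π'⟩ ∧
      overlapCount Γ D' σ' π' < overlapCount Γ D σ π ∧
      FalseC Γ (Clause.subst σ' D') π' ∧ ∃ δ, π'.Solution δ := by
  classical
  cases h with
  | mk Γ _ _ _ C L _ _ a L' σ' π' C' ha ρ ρ₀ η η₀ σs πs _ hρ hη hρ₀ hη₀ hσ hσ' hne hπ =>
  subst ha
  have sol : ∀ δ, πs.Solution δ →
      π.Solution (groundComp η δ) ∧ π'.Solution (groundComp η δ ∘ ρ) := fun δ hδ =>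
    (jointConstraint_solution ..).1 ((hπ δ).1 hδ)
  have hC : ∀ M ∈ C, ∀ δ, ((M.subst η₀).subst σs).ground δ =
      (M.subst σ).ground (groundComp η δ) := fun M hM =>
    Lit.ground_subst_eq_of_comp fun x hx => hσ x ⟨M, Multiset.mem_cons_of_mem hM, hx⟩
  have hC' : ∀ M ∈ C', ∀ δ, (((M.subst (renameSubst ρ₀)).subst η₀).subst σs).ground δ =
      (M.subst σ').ground (groundComp η δ ∘ ρ) := fun M hM δ => by
    have := Lit.ground_subst_eq_of_comp (L := M) (η₀ := comp (renameSubst ρ₀) η₀) (σs := σs)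
      (σ := comp σ' (renameSubst ρ)) (η := η)
      (fun x hx => hσ' x ⟨M, Multiset.mem_cons_of_mem hM, hx⟩) δ
    rwa [← Lit.subst_subst, ← Lit.subst_subst, Lit.ground_rename] at this
  have hund : UndefinedL Γ (L'.subst σ') π' := hΓ.undefined_of_cons
  have hreason : ∀ M ∈ C', ∀ δ, πs.Solution δ →
      FalseLit Γ ((((M.subst (renameSubst ρ₀)).subst η₀).subst σs).ground δ) := by
    intro M hM δ hδ
    rw [hC' M hM]
    cases hΓ with
    | deduced _ _ _ _ _ _ _ _ reason => exact falseC_subst_iff.1 reason _ (sol δ hδ).2 M hM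
  refine ⟨_, _, _, rfl, ?_, falseC_subst_iff.2 fun δ hδ M hM => ?_, ?_⟩
  · have hL : Overlaps (.deduced L' σ' π' C') σ π L := by
      obtain ⟨_, δ, hδ, -⟩ := hne
      have hs := (jointConstraint_solution ..).1 hδ
      refine ⟨_, hs.1, _, hs.2, ?_⟩
      rw [← Lit.ground_rename, ← Lit.ground_neg, ← Lit.ground_subst, ← Lit.ground_subst]
      exact congrArg (Lit.ground δ) (hη.1 _ (by simp) _ (by simp))
    have h₁ : (Multiset.map (Lit.subst η₀) C).countP (Overlaps (.deduced L' σ' π' C') σs πs) ≤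
        C.countP (Overlaps (.deduced L' σ' π' C') σ π) := by
      refine countP_map_le _ _ _ _ ?_
      rintro M hM ⟨δ, hδ, hcov⟩
      rw [hC M hM] at hcov
      exact ⟨_, (sol δ hδ).1, hcov⟩
    have h₂ : (Multiset.map (Lit.subst η₀) (Clause.subst (renameSubst ρ₀) C')).countP
        (Overlaps (.deduced L' σ' π' C') σs πs) = 0 := by
      refine Multiset.countP_eq_zero.2 ?_
      rintro M hM ⟨δ, hδ, hcov⟩
      obtain ⟨M', hM', rfl⟩ := Multiset.mem_map.1 hM
      obtain ⟨K, hK, rfl⟩ := Multiset.mem_map.1 hM'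
      exact Assignment.Defines.not_mem_of_undefined hΓ.undefined_of_cons (Or.inr hcov)
        (hreason K hK δ hδ).defined
    change Multiset.countP _ (Multiset.map _ (C + _)) < Multiset.countP _ (L ::ₘ C)
    rw [Multiset.map_add, Multiset.countP_add, h₂, Multiset.countP_cons_of_pos _ hL]
    omega
  · obtain ⟨K, hK, rfl⟩ := Multiset.mem_map.1 hM
    rcases Multiset.mem_add.1 hK with hK | hK
    · rw [hC K hK]
      exact falseC_subst_iff.1 hD _ (sol δ hδ).1 K (Multiset.mem_cons_of_mem hK)
    · obtain ⟨M', hM', rfl⟩ := Multiset.mem_map.1 hK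
      exact (hreason M' hM' δ hδ).mono (List.subset_cons_self _ _)
  · obtain ⟨_, δ, hδ, -⟩ := hne
    exact ⟨δ, (hπ δ).2 hδ⟩

/-- Instances of the factor are instances of the old clause, so falsity persists and no new overlaps
arise. -/
theorem Factorize.card_and_conflict {Γ : Trail S V} {k : ℤ} {D : FClause S V} {σ : Subst S V}
    {π : Constraint S V} {s' : State S V}
    (h : Factorize ⟨Γ, N, U, k, .conflict D σ π⟩ s') (hD : FalseC Γ (Clause.subst σ D) π) :
    ∃ D' σ' π', s' = ⟨Γ, N, U, k, .conflict D' σ' π'⟩ ∧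
      overlapCount Γ D' σ' π' ≤ overlapCount Γ D σ π ∧ Multiset.card D' < Multiset.card D ∧
      FalseC Γ (Clause.subst σ' D') π' ∧ ∃ δ, π'.Solution δ := by
  classical
  cases h with
  | mk Γ _ _ _ C L₁ L₂ _ _ a ρ η η₀ σs πs hρ hη hη₀ hσ hne hπ =>
  have sol : ∀ δ, πs.Solution δ → π.Solution (groundComp η δ) := fun δ hδ =>
    (Constraint.solution_subst ..).1 ((hπ δ).1 hδ)
  have hsub : ∀ M ∈ L₁ ::ₘ C, M ∈ L₁ ::ₘ L₂ ::ₘ C := by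
    intro M hM
    simp only [Multiset.mem_cons] at hM ⊢
    tauto
  have hC : ∀ M ∈ L₁ ::ₘ C, ∀ δ, ((M.subst η₀).subst σs).ground δ =
      (M.subst σ).ground (groundComp η δ) := fun M hM =>
    Lit.ground_subst_eq_of_comp fun x hx => hσ x ⟨M, hsub M hM, hx⟩
  refine ⟨_, _, _, rfl, ?_, by simp [Clause.subst], falseC_subst_iff.2 fun δ hδ M hM => ?_, ?_⟩
  · refine (countP_map_le _ (Overlaps a σ π) _ _ ?_).trans
      (Multiset.countP_le_of_le _ (Multiset.cons_le_cons _ (Multiset.le_cons_self _ _)))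
    rintro M hM ⟨δ, hδ, hcov⟩
    rw [hC M hM] at hcov
    exact ⟨_, sol δ hδ, hcov⟩
  · obtain ⟨K, hK, rfl⟩ := Multiset.mem_map.1 hM
    rw [hC K hK]
    exact falseC_subst_iff.1 hD _ (sol δ hδ) K (hsub K hK)
  · obtain ⟨_, δ, hδ, -⟩ := hne
    refine ⟨δ, (hπ δ).2 ?_⟩
    exact ((Constraint.solution_and ..).1 hδ).1

theorem Resolve.measure_lt {s s' : State S V} (h : Resolve s s') (hs : s.Invariant) :
    s'.measure < s.measure ∧ s'.Invariant := by
  obtain ⟨Γ, N, U, k, ind⟩ := s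
  obtain ⟨D, σ, π, rfl⟩ : ∃ D σ π, ind = .conflict D σ π := by cases h; exact ⟨_, _, _, rfl⟩
  obtain ⟨D', σ', π', rfl, hlt, hc⟩ :=
    h.overlap_and_conflict hs.trail (hs.conflict _ _ _ rfl).1
  refine ⟨State.measure_lt_of_phaseMeasure rfl rfl ?_, hs.trail, fun _ => hs.labels_le (by simp),
    fun _ => hs.level_pos (by simp), ?_⟩
  · simp [State.phaseMeasure, Prod.Lex.toLex_lt_toLex, hlt]
  · rintro _ _ _ ⟨⟩
    exact hc

theorem Factorize.measure_lt {s s' : State S V} (h : Factorize s s') (hs : s.Invariant) :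
    s'.measure < s.measure ∧ s'.Invariant := by
  obtain ⟨Γ, N, U, k, ind⟩ := s
  obtain ⟨D, σ, π, rfl⟩ : ∃ D σ π, ind = .conflict D σ π := by cases h; exact ⟨_, _, _, rfl⟩
  obtain ⟨D', σ', π', rfl, hle, hlt, hc⟩ := h.card_and_conflict (hs.conflict _ _ _ rfl).1
  refine ⟨State.measure_lt_of_phaseMeasure rfl rfl ?_, hs.trail, fun _ => hs.labels_le (by simp),
    fun _ => hs.level_pos (by simp), ?_⟩
  · simpa [State.phaseMeasure, Prod.Lex.toLex_lt_toLex, hlt] using hle.lt_or_eq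
  · rintro _ _ _ ⟨⟩
    exact hc

theorem Skip.measure_lt [Infinite V] {s s' : State S V} (h : Skip s s') (hs : s.Invariant) :
    s'.measure < s.measure ∧ s'.Invariant := by
  cases h with
  | mk Γ N U k C σ π a ha h =>
  obtain ⟨L', σ', π', C', rfl⟩ := ha
  refine ⟨State.measure_lt_of_phaseMeasure rfl rfl ?_, hs.trail.tail_of_cons,
    fun _ => hs.labels_le (by simp), fun _ => hs.level_pos (by simp), ?_⟩
  · simp [State.phaseMeasure, Prod.Lex.toLex_lt_toLex]
  · rintro _ _ _ ⟨⟩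
    have hc := hs.conflict _ _ _ rfl
    refine ⟨falseC_subst_iff.2 fun δ hδ L hL => ?_, hc.2⟩
    obtain ⟨a, ha, hal⟩ := falseC_subst_iff.1 hc.1 δ hδ L hL
    rcases List.mem_cons.1 ha with rfl | ha
    -- A literal falsified by the skipped element would have made Skip inapplicable.
    · exact absurd ⟨L, hL, exists_overlap _ hδ hL hal⟩ h
    · exact ⟨a, ha, hal⟩

instance GLit.finite [Finite S.Pred] [Finite S.Const] : Finite (GLit S) :=
  Finite.of_injective
    (fun l : GLit S => ((l.pos, ⟨l.atom.pred, l.atom.args⟩) :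
      Bool × (p : S.Pred) × (Fin (S.arity p) → S.Const)))
    fun l l' h => by
      obtain ⟨b, p, f⟩ := l
      obtain ⟨b', p', f'⟩ := l'
      simp only [Prod.mk.injEq, Sigma.mk.injEq] at h
      obtain ⟨rfl, rfl, h⟩ := h
      rw [eq_of_heq h]

/-- The invariant is not claimed for `s'`: the trail conditions refer to the clause set, which has
grown. -/
theorem Backjump.measure_lt [Infinite V] [Finite S.Pred] [Finite S.Const] {s s' : State S V}
    (h : Backjump s s') (hs : s.Invariant) : s'.measure < s.measure := by
  classical
  cases h with
  | mk Γ₁ Γ₂ N U k C σ π hk h =>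
  by_cases h0 : (0 : FClause S V) ∈ N ∪ (U ∪ {C})
  · apply State.measure_lt_of_rank
    have : ¬ (level Γ₁ : ℤ) < 0 := by omega
    simp only [State.rank, if_neg this, if_pos h0]
    split_ifs <;> norm_num
  have h0' : (0 : FClause S V) ∉ N ∪ U := fun h => h0 (by
    rw [← Set.union_assoc]
    exact Or.inl h)
  obtain ⟨hfalse, δ, hδ⟩ := hs.conflict _ _ _ rfl
  have hpos : 0 < k → 0 < level (Γ₂ ++ Γ₁) := hs.level_pos (by simp)
  have new : ∃ G ∈ gnd C, profile G ∉ profiles (N ∪ U) := by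
    rcases h with ⟨-, rfl⟩ | ⟨hk, ⟨G, hG, hass⟩, -⟩ | ⟨hk, ⟨L', π', Γ₂', hΓ⟩, hass, hfac, -⟩
    · exact absurd (Or.inr (Or.inr rfl)) h0
    · exact ⟨G, gndClause_subset_gnd _ _ _ hG,
        hs.trail.profile_notMem_of_assertive (hpos hk) hass⟩
    -- The annotation is abstracted because it mentions `Γ₂`, which is to be eliminated.
    · generalize level (Γ₂ ++ Γ₁) = i at hΓ
      subst hΓ
      have hG : Clause.ground δ (Clause.subst σ C) ∈ gndClause (Clause.subst σ C) π := ⟨δ, hδ, rfl⟩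
      refine ⟨_, gndClause_subset_gnd _ _ _ hG, GoodTrail.profile_notMem_of_decision hs.trail
        (hpos hk) (hfalse _ hG) (fun h => hass ⟨_, hG, h⟩) fun l hl hdouble => ?_⟩
      exact hfac (applicable_factorize _ _ k hδ hdouble hl)
  obtain ⟨G, hG, hnew⟩ := new
  have hlt : (profiles (N ∪ (U ∪ {C})))ᶜ.ncard < (profiles (N ∪ U))ᶜ.ncard := by
    refine Set.ncard_lt_ncard (compl_lt_compl_iff_lt.2 ⟨?_, fun hsub =>
      hnew (hsub ⟨C, Or.inr (Or.inr rfl), G, hG, rfl⟩)⟩) (Set.toFinite _)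
    rintro p ⟨D, hD, h⟩
    refine ⟨D, ?_, h⟩
    rw [← Set.union_assoc]
    exact Or.inl hD
  refine Prod.Lex.toLex_lt_toLex.2 (Or.inr ⟨?_, Prod.Lex.toLex_lt_toLex.2 (Or.inl hlt)⟩)
  have : ¬ (level Γ₁ : ℤ) < 0 := by omega
  simp only [State.rank, if_neg this, if_neg h0, if_neg h0']

/-! ### Conflict search -/

theorem Failure.measure_lt {s s' : State S V} (h : Failure s s') (hs : s.Invariant) :
    s'.measure < s.measure ∧ s'.Invariant := by
  cases h with
  | mk Γ N U k h =>
  refine ⟨State.measure_lt_of_rank ?_, hs.trail, fun h => absurd rfl h, fun h => absurd rfl h,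
    fun _ _ _ h => by cases h⟩
  simp only [State.rank]
  split_ifs <;> norm_num

theorem Success.measure_lt {s s' : State S V} (h : Success s s') (hs : s.Invariant) :
    s'.measure < s.measure ∧ s'.Invariant := by
  cases h with
  | mk Γ N U k h =>
  refine ⟨State.measure_lt_of_rank ?_, hs.trail, fun _ h => ?_, fun _ h => ?_,
    fun _ _ _ h => by cases h⟩
  · have : ¬ (k : ℤ) < 0 := by omega
    simp only [State.rank, if_neg this, if_pos (show (-1 : ℤ) < 0 by norm_num)]
    split_ifs <;> norm_num
  · exact absurd h (by norm_num)
  · exact absurd h (by norm_num)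

theorem zero_notMem_of_not_applicable {Γ : Trail S V} {k : ℤ}
    (h : ¬ Applicable Failure ⟨Γ, N, U, k, .top⟩) : (0 : FClause S V) ∉ N ∪ U :=
  fun h0 => h ⟨_, .mk Γ N U k h0⟩

/-- A false ground instance, as a closure with trivial constraint, would allow Conflict; ⊥, which
Conflict excludes, would allow Failure. -/
theorem no_false_of_not_applicable {Γ : Trail S V} {k : ℕ}
    (hF : ¬ Applicable Failure ⟨Γ, N, U, k, .top⟩)
    (hC : ¬ Applicable Conflict ⟨Γ, N, U, k, .top⟩) :
    ∀ C ∈ N ∪ U, ¬ HasFalseInstance Γ C := by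
  rintro C hCM ⟨_, ⟨δ, rfl⟩, hfalse⟩
  refine hC ⟨_, .mk Γ N U k C (groundSubst δ) [] hCM ?_ (fun G hG => ?_)
    ⟨_, δ, Constraint.solution_nil _, rfl⟩⟩
  · rintro rfl
    exact zero_notMem_of_not_applicable hF hCM
  · rw [gndClause_groundSubst _ _ hG]
    exact hfalse

theorem Conflict.measure_lt {s s' : State S V} (h : Conflict s s') (hs : s.Invariant)
    (hF : ¬ Applicable Failure s) : s'.measure < s.measure ∧ s'.Invariant := by
  cases h with
  | mk Γ N U k C σ π hC hbot hfalse hne =>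
  -- Without ⊥ both states have rank 4; with it, Conflict would raise the rank from 2 to 3.
  have h0 := zero_notMem_of_not_applicable hF
  refine ⟨State.measure_lt_of_phaseMeasure ?_ rfl ?_, hs.trail, fun _ => hs.labels_le (by simp),
    fun _ => hs.level_pos (by simp), ?_⟩
  · have : ¬ (k : ℤ) < 0 := by omega
    simp only [State.rank, if_neg this, if_neg h0]
  · simp [State.phaseMeasure, Prod.Lex.toLex_lt_toLex]
  · rintro _ _ _ ⟨⟩
    obtain ⟨_, δ, hδ, -⟩ := hne
    exact ⟨hfalse, δ, hδ⟩

theorem ncard_undefined_cons_lt [Finite S.Pred] [Finite S.Const] {Γ : Trail S V}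
    {a : Assignment S V} (hund : UndefinedL Γ a.lit a.constr) (hne : a.covers.Nonempty) :
    {l | ¬ DefinedLit (a :: Γ) l}.ncard < {l | ¬ DefinedLit Γ l}.ncard := by
  obtain ⟨l, hl⟩ := hne
  refine Set.ncard_lt_ncard ⟨fun x hx hx' => hx ?_, fun hsub =>
    hsub (hund l hl) ⟨a, List.mem_cons_self .., Or.inl hl⟩⟩ (Set.toFinite _)
  obtain ⟨b, hb, hbx⟩ := hx'
  exact ⟨b, List.mem_cons_of_mem _ hb, hbx⟩

theorem Propagate.measure_lt [Finite S.Pred] [Finite S.Const] {s s' : State S V}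
    (h : Propagate s s') (hs : s.Invariant) (hF : ¬ Applicable Failure s)
    (hC : ¬ Applicable Conflict s) : s'.measure < s.measure ∧ s'.Invariant := by
  cases h with
  | mk Γ N U k L σ π C h =>
  refine ⟨State.measure_lt_of_phaseMeasure rfl rfl ?_,
    .deduced _ _ _ _ _ hs.trail (no_false_of_not_applicable hF hC) h.2.2.1 h.2.1,
    fun _ => hs.labels_le (by simp), fun _ => hs.level_pos (by simp), fun _ _ _ h => by cases h⟩
  have := ncard_undefined_cons_lt (a := .deduced L σ π C) h.2.2.1 h.2.2.2
  simp [State.phaseMeasure, Prod.Lex.toLex_lt_toLex, this]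

theorem Decide.measure_lt [Finite S.Pred] [Finite S.Const] {s s' : State S V}
    (h : Decide s s') (hs : s.Invariant) (hF : ¬ Applicable Failure s)
    (hC : ¬ Applicable Conflict s) (hP : ¬ Applicable Propagate s) :
    s'.measure < s.measure ∧ s'.Invariant := by
  cases h with
  | mk Γ N U k L π h =>
  have hlabels : ∀ i ∈ decisionLabels Γ, (i : ℤ) ≤ k := hs.labels_le (by simp) (by simp)
  refine ⟨State.measure_lt_of_phaseMeasure ?_ rfl ?_,
    .decision _ _ _ _ hs.trail (no_false_of_not_applicable hF hC) h.1 h.2.1 (fun j hj => ?_) ?_,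
    fun _ _ i hi => ?_, fun _ _ => Nat.succ_pos k, fun _ _ _ h => by cases h⟩
  · have h₁ : ¬ (k : ℤ) < 0 := by omega
    have h₂ : ¬ (k : ℤ) + 1 < 0 := by omega
    simp only [State.rank, if_neg h₁, if_neg h₂]
  · have := ncard_undefined_cons_lt (a := .decision L π (k + 1)) h.1 h.2.2.1
    simp [State.phaseMeasure, Prod.Lex.toLex_lt_toLex, this]
  · have := hlabels j hj
    omega
  · rintro ⟨L', σ', π', C', h⟩
    exact hP ⟨_, .mk Γ N U k L' σ' π' C' h⟩
  · rcases List.mem_cons.1 hi with rfl | hi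
    · simp
    · have := hlabels i hi
      simp only
      omega

/-! ### Termination -/

theorem SearchStep.measure_lt [Finite S.Pred] [Finite S.Const] {o : SearchOrder}
    {s s' : State S V} (h : SearchStep o s s') (hs : s.Invariant) :
    s'.measure < s.measure ∧ s'.Invariant := by
  cases o with
  | successFirst =>
    rcases h with h | h | ⟨hF, -, h | ⟨hC, h⟩ | ⟨hC, hP, h⟩⟩
    exacts [h.measure_lt hs, h.measure_lt hs, h.measure_lt hs hF, h.measure_lt hs hF hC,
      h.measure_lt hs hF hC hP]
  | successLast =>
    rcases h with h | ⟨hF, h | ⟨hC, h⟩ | ⟨hC, hP, h⟩ | ⟨-, -, -, h⟩⟩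
    exacts [h.measure_lt hs, h.measure_lt hs hF, h.measure_lt hs hF hC,
      h.measure_lt hs hF hC hP, h.measure_lt hs]

theorem ResolutionStep.measure_lt [Infinite V] [Finite S.Pred] [Finite S.Const]
    {s s' : State S V} (h : ResolutionStep s s') (hs : s.Invariant) :
    s'.measure < s.measure ∧ s'.Invariant := by
  rcases h with ⟨h, hreg⟩ | ⟨-, h | h | h⟩
  exacts [⟨h.measure_lt hs, hreg.invariant⟩, h.measure_lt hs, h.measure_lt hs, h.measure_lt hs]

theorem IsRegularRun.terminates [Infinite V] [Finite S.Pred] [Finite S.Const]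
    {o : SearchOrder} {M : Set (FClause S V)} {run : Stream'.Seq (State S V)}
    (h : IsRegularRun o M run) : run.Terminates := by
  by_contra hinf
  have hsome : ∀ n, ∃ s, run.get? n = some s := by
    intro n
    by_contra hn
    exact hinf ⟨n, Option.eq_none_iff_forall_not_mem.2 fun s hs => hn ⟨s, hs⟩⟩
  choose f hf using hsome
  have step : ∀ n, (f n).Invariant →
      (f (n + 1)).measure < (f n).measure ∧ (f (n + 1)).Invariant := fun n hn =>
    (h.regular_step n _ _ (hf n) (hf (n + 1))).elim (·.measure_lt hn) (·.measure_lt hn)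
  have inv : ∀ n, (f n).Invariant := by
    intro n
    induction n with
    | zero => exact (h.start_regular _ (hf 0)).invariant
    | succ n ih => exact (step n ih).2
  exact (RelEmbedding.natGT (r := (· < ·)) (fun n => (f n).measure)
    fun n => (step n (inv n)).1).not_wellFounded wellFounded_lt

end

end NRCL

/-- Termination: if the clause set, the signature and the domain are finite, then every regular run
of NRCL is finite. -/
theorem mainTheorem2 {S : NRCL.Signature.{u, v}} {V : Type w} [Infinite V]
    [Finite S.Pred] [Finite S.Const] [Nonempty S.Const]
    (N : Set (NRCL.FClause S V)) (hN : N.Finite)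
    (o : NRCL.SearchOrder) (run : Stream'.Seq (NRCL.State S V))
    (hrun : NRCL.IsRegularRun o N run) :
    run.Terminates := hrun.terminates
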